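/- Let $n=1$ and write points of $\mathbb{R}^{2}$ as $(t,x)$. For $c\in\mathbb{R}^2$ and $r>0$ let $Q=Q(c,r)$ denote the open axes-parallel cube (square) with centre $c$ and side length $2r$, and $2Q:=Q(c,2r)$. Let $A:\mathbb{R}\to\mathbb{C}^{2\times 2}$ be measurable and essentially bounded, and suppose that for some $\lambda>0$ one has $\operatorname{Re}\langle A(x)\xi,\xi\rangle\ge\lambda|\xi|^2$ for a.e. $x\in\mathbb{R}$ and all $\xi\in\mathbb{C}^2$. Put $\mathcal{L}U=-\operatorname{div}_{t,x}\big(A(x)\nabla_{t,x}U\big)$, with coefficients independent of $t$. A function $U$ is called $\mathcal{L}$-harmonic in an open set $\Omega\subseteq\mathbb{R}^2$ if $U\in W^{1,2}_{\mathrm{loc}}(\Omega)$ (complex-valued) and $\int_\Omega A\nabla_{t,x}U\cdot\overline{\nabla_{t,x}\varphi}\,d(t,x)=0$ for all $\varphi\in C_c^\infty(\Omega)$. The Meyers exponent $m_+(\mathcal{L})\in[2,\infty]$ is the supremum of all $p\in[2,\infty)$ for which there is a constant $C_p>0$ such that $$\Big(\frac{1}{|Q|}\int_Q|\nabla_{t,x}U|^p\,d(t,x)\Big)^{1/p}\le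 C_p\Big(\frac{1}{|2Q|}\int_{2Q}|\nabla_{t,x}U|^2\,d(t,x)\Big)^{1/2}$$ for every cube $Q\subseteq\mathbb{R}^2$ and every $\mathcal{L}$-harmonic $U$ in $2Q$. Then there is a constant $C>0$, depending only on $\lambda$ and (an upper bound for) $\|A\|_{L^\infty}$, such that for every cube $Q\subseteq\mathbb{R}^2$ and every $\mathcal{L}$-harmonic $U$ in $2Q$, $$\|\nabla_{t,x}U\|_{L^\infty(Q)}\le C\Big(\frac{1}{|2Q|}\int_{2Q}|\nabla_{t,x}U|^2\,d(t,x)\Big)^{1/2},$$ where the right-hand side may be $+\infty$. In particular, $m_+(\mathcal{L})=\infty$. -/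

import Mathlib

open MeasureTheory Set
open scoped ENNReal ContDiff Matrix

namespace MeyersPlane

/-- The space `ℂ^{1+1}` with its Euclidean norm; component `0` is the `t`-component and
component `1` is the `x`-component. -/
abbrev C2 : Type := EuclideanSpace ℂ (Fin 2)

/-- The open axes-parallel cube `Q(c, r)` with center `c` and side length `2r` in the
`(t, x)`-plane. The dilated cube `2Q` is `cube c (2 * r)`. -/
def cube (c : ℝ × ℝ) (r : ℝ) : Set (ℝ × ℝ) :=
  Ioo (c.1 - r) (c.1 + r) ×ˢ Ioo (c.2 - r) (c.2 + r)

/-- The coefficients `A = A(x)` are (Lebesgue) measurable, satisfy `‖A‖_∞ ≤ M` (essential supremum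
of the operator norm) and are strongly elliptic with constant `lam`. -/
structure IsEllipticCoeff (lam M : ℝ) (A : ℝ → Matrix (Fin 2) (Fin 2) ℂ) : Prop where
  aemeasurable : ∀ i j, AEMeasurable (fun x => A x i j) volume
  bounded : ∀ᵐ x, ‖Matrix.toEuclideanCLM (𝕜 := ℂ) (A x)‖ ≤ M
  elliptic : ∀ᵐ x, ∀ ξ : C2,
    lam * ‖ξ‖ ^ 2 ≤ ((A x *ᵥ ξ.ofLp) ⬝ᵥ star ξ.ofLp).re

/-- `φ ∈ C_c^∞(Ω)`, complex-valued. -/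
structure IsTestFunction (Ω : Set (ℝ × ℝ)) (φ : ℝ × ℝ → ℂ) : Prop where
  smooth : ContDiff ℝ ∞ φ
  compact : HasCompactSupport φ
  subset : tsupport φ ⊆ Ω

/-- The classical gradient `∇_{t,x} φ = (∂_t φ, ∂_x φ)`. -/
noncomputable def grad (φ : ℝ × ℝ → ℂ) (z : ℝ × ℝ) : C2 :=
  !₂[fderiv ℝ φ z (1, 0), fderiv ℝ φ z (0, 1)]

/-- `f ∈ L²_loc(Ω)`. -/
def MemL2Loc {E : Type*} [NormedAddCommGroup E] (Ω : Set (ℝ × ℝ)) (f : ℝ × ℝ → E) : Prop :=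
  ∀ K ⊆ Ω, IsCompact K → MemLp f 2 (volume.restrict K)

/-- `U ∈ W^{1,2}_loc(Ω)`, and `G` is (a representative of) its weak gradient on `Ω`. -/
structure HasWeakGradient (Ω : Set (ℝ × ℝ)) (U : ℝ × ℝ → ℂ) (G : ℝ × ℝ → C2) : Prop where
  memL2Loc : MemL2Loc Ω U
  grad_memL2Loc : MemL2Loc Ω G
  integral_eq : ∀ φ, IsTestFunction Ω φ → ∀ i : Fin 2,
    ∫ z in Ω, U z * grad φ z i = -∫ z in Ω, G z i * φ z

/-- `U` is `𝓛`-harmonic in `Ω`, where `𝓛 U = -div_{t,x} (A(x) ∇_{t,x} U)`, and `G` is its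
weak gradient: `U ∈ W^{1,2}_loc(Ω)` and `∫_Ω A ∇U · conj(∇φ) = 0` for all `φ ∈ C_c^∞(Ω)`. -/
structure IsHarmonic (A : ℝ → Matrix (Fin 2) (Fin 2) ℂ) (Ω : Set (ℝ × ℝ))
    (U : ℝ × ℝ → ℂ) (G : ℝ × ℝ → C2) : Prop where
  hasWeakGradient : HasWeakGradient Ω U G
  weak_eq : ∀ φ, IsTestFunction Ω φ →
    ∫ z in Ω, (A z.2 *ᵥ (G z).ofLp) ⬝ᵥ star (grad φ z).ofLp = 0

/-- The quadratic mean `(⨍_S |G|²)^{1/2}`, with values in `[0, ∞]`. -/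
noncomputable def quadMean (S : Set (ℝ × ℝ)) (G : ℝ × ℝ → C2) : ℝ≥0∞ :=
  (⨍⁻ z in S, ‖G z‖ₑ ^ (2 : ℝ) ∂volume) ^ (1 / 2 : ℝ)

/-- The weak reverse Hölder estimate with exponent `p` and constant `C`:
`(⨍_Q |∇U|^p)^{1/p} ≤ C (⨍_{2Q} |∇U|²)^{1/2}` for all cubes `Q` and all `𝓛`-harmonic `U` in `2Q`. -/
def WeakReverseHolder (A : ℝ → Matrix (Fin 2) (Fin 2) ℂ) (p C : ℝ) : Prop :=
  ∀ (c : ℝ × ℝ) (r : ℝ), 0 < r → ∀ (U : ℝ × ℝ → ℂ) (G : ℝ × ℝ → C2),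
    IsHarmonic A (cube c (2 * r)) U G →
      (⨍⁻ z in cube c r, ‖G z‖ₑ ^ p ∂volume) ^ (1 / p) ≤
        ENNReal.ofReal C * quadMean (cube c (2 * r)) G

/-- The Meyers exponent `m_+(𝓛)`: the supremum in `[0, ∞]` of all `p ∈ [2, ∞)` for which the weak
reverse Hölder estimate holds with some constant. -/
noncomputable def meyersExponent (A : ℝ → Matrix (Fin 2) (Fin 2) ℂ) : ℝ≥0∞ :=
  sSup (ENNReal.ofReal '' {p : ℝ | 2 ≤ p ∧ ∃ C > 0, WeakReverseHolder A p C})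

end MeyersPlane

namespace MeyersPlane

open Filter Topology Convolution


/-! Since the coefficients do not depend on $t$, difference quotients in $t$ of a solution are again
solutions. Caccioppoli's inequality, applied once and then a second time, bounds the first and
second $t$-difference quotients of $\nabla U$ in $L^2$ on smaller cubes by $\|\nabla U\|_{L^2}$
(`exists_caccioppoli`, `exists_dq_estimate`).

No comparable control is available in the $x$-direction, where $A$ is merely measurable. In one
dimension the equations supply it: with $G=\nabla U$ and $F=AG$, one has $\partial_x G_0=\partial_t
G_1$ because $G$ is curl-free, and $\partial_x F_1=-\partial_t F_0$ because $F$ is divergence-free.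
Thus $G_0$ and the conormal component $F_1$ both have an $x$-derivative that is a $t$-derivative of
an $L^2$ function with good $t$-regularity. The one-dimensional Sobolev embedding, used in $x$ and
then in $t$, bounds such a function $p$ with $\partial_x p=-\partial_t q$ by integrals of $p$,
$\partial_t p$, $\partial_t q$ and $\partial_t^2 q$ (`enorm_le_lintegral_ball`, `ae_norm_le_of_dq`).
Finally $G_1=(F_1-A_{10}G_0)/A_{11}$, where $|A_{11}|\ge\lambda$ by ellipticity
(`exists_flux_bound`).

Derivatives are handled weakly throughout and become classical only after mollification; every bound
is uniform in the mollification parameter. The norm on $\mathbb R\times\mathbb R$ is the sup norm,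
so cubes are metric balls. -/

lemma cube_eq_ball (c : ℝ × ℝ) (r : ℝ) : cube c r = Metric.ball c r := by
  rw [cube, ← Real.ball_eq_Ioo, ← Real.ball_eq_Ioo, ball_prod_same]

/-! ### Weak first-order relations: translation, difference quotients, mollification. -/

/-- The first-order weak relation `∂_e a + ∂_f b = c` on `Ω`. -/
def WeakRel (Ω : Set (ℝ × ℝ)) (e f : ℝ × ℝ) (a b c : ℝ × ℝ → ℂ) : Prop :=
  ∀ φ, IsTestFunction Ω φ →
    ∫ z, (a z * fderiv ℝ φ z e + b z * fderiv ℝ φ z f + c z * φ z) = 0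

lemma IsTestFunction.mono {Ω Ω' : Set (ℝ × ℝ)} {φ : ℝ × ℝ → ℂ} (hφ : IsTestFunction Ω φ)
    (h : Ω ⊆ Ω') : IsTestFunction Ω' φ :=
  ⟨hφ.smooth, hφ.compact, hφ.subset.trans h⟩

lemma WeakRel.mono {Ω Ω' : Set (ℝ × ℝ)} {e f : ℝ × ℝ} {a b c : ℝ × ℝ → ℂ}
    (h : WeakRel Ω' e f a b c) (hs : Ω ⊆ Ω') : WeakRel Ω e f a b c :=
  fun φ hφ => h φ (hφ.mono hs)

lemma IsTestFunction.continuous_fderiv {Ω : Set (ℝ × ℝ)} {φ : ℝ × ℝ → ℂ}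
    (hφ : IsTestFunction Ω φ) (e : ℝ × ℝ) : Continuous fun z => fderiv ℝ φ z e :=
  (hφ.smooth.continuous_fderiv (by simp)).clm_apply continuous_const

lemma IsTestFunction.memLp {Ω : Set (ℝ × ℝ)} {φ : ℝ × ℝ → ℂ} (hφ : IsTestFunction Ω φ) :
    MemLp φ 2 volume :=
  hφ.smooth.continuous.memLp_of_hasCompactSupport hφ.compact

lemma IsTestFunction.memLp_fderiv {Ω : Set (ℝ × ℝ)} {φ : ℝ × ℝ → ℂ}
    (hφ : IsTestFunction Ω φ) (e : ℝ × ℝ) : MemLp (fun z => fderiv ℝ φ z e) 2 volume :=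
  (hφ.continuous_fderiv e).memLp_of_hasCompactSupport (hφ.compact.fderiv_apply ℝ e)

lemma integrable_mul_of_memLp_two {a b : ℝ × ℝ → ℂ} (ha : MemLp a 2 volume)
    (hb : MemLp b 2 volume) : Integrable (fun z => a z * b z) volume :=
  ha.integrable_mul hb

lemma integrable_weakRel {Ω : Set (ℝ × ℝ)} {φ a b c : ℝ × ℝ → ℂ} (hφ : IsTestFunction Ω φ)
    (e f : ℝ × ℝ) (ha : MemLp a 2 volume) (hb : MemLp b 2 volume) (hc : MemLp c 2 volume) :
    Integrable (fun z => a z * fderiv ℝ φ z e + b z * fderiv ℝ φ z f + c z * φ z) volume :=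
  ((integrable_mul_of_memLp_two ha (hφ.memLp_fderiv e)).add
    (integrable_mul_of_memLp_two hb (hφ.memLp_fderiv f))).add
    (integrable_mul_of_memLp_two hc hφ.memLp)

lemma memLp_translate {a : ℝ × ℝ → ℂ} (ha : MemLp a 2 volume) (v : ℝ × ℝ) :
    MemLp (fun z => a (z + v)) 2 volume :=
  ha.comp_measurePreserving (measurePreserving_add_right volume v)

/-- Giving up a margin $s$ in the radius pays for a shift of length at most $s$; all later losses of
radius are of this kind. -/
lemma IsTestFunction.translate {c : ℝ × ℝ} {R s : ℝ} {φ : ℝ × ℝ → ℂ}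
    (hφ : IsTestFunction (Metric.ball c (R - s)) φ) {v : ℝ × ℝ} (hv : ‖v‖ ≤ s) :
    IsTestFunction (Metric.ball c R) (fun z => φ (z - v)) where
  smooth := hφ.smooth.comp (contDiff_id.sub contDiff_const)
  compact := hφ.compact.comp_homeomorph (Homeomorph.subRight v)
  subset := by
    intro z hz
    have h1 : z - v ∈ tsupport φ := by
      have := tsupport_comp_subset_preimage φ (f := fun z => z - v) (by fun_prop) hz
      exact this
    have h2 := hφ.subset h1
    rw [mem_ball_iff_norm] at h2 ⊢
    calc ‖z - c‖ = ‖(z - v - c) + v‖ := by congr 1; abel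
      _ ≤ ‖z - v - c‖ + ‖v‖ := norm_add_le _ _
      _ < R := by linarith

lemma WeakRel.translate {c : ℝ × ℝ} {R s : ℝ} {e f : ℝ × ℝ} {a b d : ℝ × ℝ → ℂ}
    (h : WeakRel (Metric.ball c R) e f a b d) {v : ℝ × ℝ} (hv : ‖v‖ ≤ s) :
    WeakRel (Metric.ball c (R - s)) e f (fun z => a (z + v)) (fun z => b (z + v))
      (fun z => d (z + v)) := by
  intro φ hφ
  have := h _ (hφ.translate hv)
  rw [← integral_add_right_eq_self _ v] at this
  simpa [fderiv_comp_sub] using this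

lemma WeakRel.const_mul {Ω : Set (ℝ × ℝ)} {e f : ℝ × ℝ} {a b d : ℝ × ℝ → ℂ}
    (h : WeakRel Ω e f a b d) (k : ℂ) :
    WeakRel Ω e f (fun z => k * a z) (fun z => k * b z) (fun z => k * d z) := by
  intro φ hφ
  have := congrArg (k * ·) (h φ hφ)
  simp only [mul_zero, ← integral_const_mul] at this
  rw [← this]
  congr 1; ext z; ring

lemma WeakRel.sub {Ω : Set (ℝ × ℝ)} {e f : ℝ × ℝ} {a b d a' b' d' : ℝ × ℝ → ℂ}
    (h : WeakRel Ω e f a b d) (h' : WeakRel Ω e f a' b' d')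
    (ha : MemLp a 2 volume) (hb : MemLp b 2 volume) (hd : MemLp d 2 volume)
    (ha' : MemLp a' 2 volume) (hb' : MemLp b' 2 volume) (hd' : MemLp d' 2 volume) :
    WeakRel Ω e f (fun z => a z - a' z) (fun z => b z - b' z) (fun z => d z - d' z) := by
  intro φ hφ
  have := integral_sub (integrable_weakRel hφ e f ha hb hd) (integrable_weakRel hφ e f ha' hb' hd')
  rw [h φ hφ, h' φ hφ, sub_zero] at this
  rw [← this]
  congr 1; ext z; ring

/-- The difference quotient in the `t`-direction. -/
noncomputable def dq (h : ℝ) (a : ℝ × ℝ → ℂ) (z : ℝ × ℝ) : ℂ :=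
  (h : ℂ)⁻¹ * (a (z + (h, 0)) - a z)

lemma memLp_dq {a : ℝ × ℝ → ℂ} (ha : MemLp a 2 volume) (h : ℝ) : MemLp (dq h a) 2 volume :=
  ((memLp_translate ha (h, 0)).sub ha).const_mul _

lemma norm_prod_zero (h : ℝ) : ‖((h, 0) : ℝ × ℝ)‖ = |h| := by simp [Prod.norm_def]

lemma dq_zero_fun (h : ℝ) : dq h (fun _ => 0) = fun _ => 0 := by
  ext z; simp [dq]

lemma WeakRel.diffQuot {c : ℝ × ℝ} {R s : ℝ} {e f : ℝ × ℝ} {a b d : ℝ × ℝ → ℂ}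
    (hr : WeakRel (Metric.ball c R) e f a b d)
    (ha : MemLp a 2 volume) (hb : MemLp b 2 volume) (hd : MemLp d 2 volume)
    {h : ℝ} (hs : |h| ≤ s) :
    WeakRel (Metric.ball c (R - s)) e f (dq h a) (dq h b) (dq h d) := by
  have hs0 : 0 ≤ s := (abs_nonneg h).trans hs
  refine WeakRel.const_mul (WeakRel.sub (hr.translate (by rwa [norm_prod_zero]))
    (hr.mono (Metric.ball_subset_ball (by linarith))) (memLp_translate ha _)
    (memLp_translate hb _) (memLp_translate hd _) ha hb hd) _

/-- Mollification by a normalised bump function. -/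
noncomputable def moll (η : ContDiffBump (0 : ℝ × ℝ)) (a : ℝ × ℝ → ℂ) : ℝ × ℝ → ℂ :=
  η.normed volume ⋆[ContinuousLinearMap.lsmul ℝ ℝ, volume] a

lemma moll_apply (η : ContDiffBump (0 : ℝ × ℝ)) (a : ℝ × ℝ → ℂ) (z : ℝ × ℝ) :
    moll η a z = ∫ y, η.normed volume (z - y) • a y :=
  convolution_lsmul_swap

lemma moll_apply' (η : ContDiffBump (0 : ℝ × ℝ)) (a : ℝ × ℝ → ℂ) (z : ℝ × ℝ) :
    moll η a z = ∫ y, η.normed volume y • a (z - y) := rfl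

lemma locallyIntegrable_of_memLp_two {a : ℝ × ℝ → ℂ} (ha : MemLp a 2 volume) :
    LocallyIntegrable a volume := ha.locallyIntegrable (by norm_num)

lemma contDiff_moll (η : ContDiffBump (0 : ℝ × ℝ)) {a : ℝ × ℝ → ℂ} (ha : MemLp a 2 volume) :
    ContDiff ℝ ∞ (moll η a) :=
  η.hasCompactSupport_normed.contDiff_convolution_left _ η.contDiff_normed
    (locallyIntegrable_of_memLp_two ha)

lemma fderiv_moll (η : ContDiffBump (0 : ℝ × ℝ)) {a : ℝ × ℝ → ℂ} (ha : MemLp a 2 volume)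
    (z e : ℝ × ℝ) :
    fderiv ℝ (moll η a) z e = ∫ y, fderiv ℝ (η.normed volume) (z - y) e • a y := by
  have h := ((η.hasCompactSupport_normed (μ := volume)).hasFDerivAt_convolution_left
    (ContinuousLinearMap.lsmul ℝ ℝ) η.contDiff_normed
    (locallyIntegrable_of_memLp_two ha) z).fderiv
  have hi : HasCompactSupport (fderiv ℝ (η.normed (volume : Measure (ℝ × ℝ)))) :=
    η.hasCompactSupport_normed.fderiv ℝ
  have hc : Continuous (fderiv ℝ (η.normed (volume : Measure (ℝ × ℝ)))) :=
    (η.contDiff_normed (n := 1)).continuous_fderiv (by simp)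
  have hx := hi.convolutionExists_left ((ContinuousLinearMap.lsmul ℝ ℝ (E := ℂ)).precompL (ℝ × ℝ))
    hc (locallyIntegrable_of_memLp_two ha) z
  rw [moll, h, convolution_def, ContinuousLinearMap.integral_apply hx,
    ← integral_sub_left_eq_self _ volume z]
  simp [ContinuousLinearMap.precompL_apply]

/-- The reflected kernel is the test function that turns a weak relation into an identity between
mollifications at the point $z$. -/
lemma isTestFunction_bump (η : ContDiffBump (0 : ℝ × ℝ)) {Ω : Set (ℝ × ℝ)} {z : ℝ × ℝ}
    (hz : Metric.closedBall z η.rOut ⊆ Ω) :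
    IsTestFunction Ω (fun y => (η.normed volume (z - y) : ℂ)) where
  smooth := Complex.ofRealCLM.contDiff.comp
    ((η.contDiff_normed (n := (⊤ : ℕ∞))).comp (contDiff_const.sub contDiff_id))
  compact := ((η.hasCompactSupport_normed (μ := volume)).comp_homeomorph
    (Homeomorph.subLeft z)).comp_left (g := fun x : ℝ => (x : ℂ)) (by simp)
  subset := by
    refine subset_trans ?_ hz
    refine closure_minimal ?_ Metric.isClosed_closedBall
    intro y hy
    have : z - y ∈ Function.support (η.normed volume) := by
      intro h0
      exact hy (by simp [h0])
    rw [η.support_normed_eq, mem_ball_zero_iff] at this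
    rw [mem_closedBall_iff_norm, ← norm_neg, neg_sub]
    exact this.le

/-- A weak relation becomes a classical one after mollification. -/
lemma WeakRel.mollify {Ω : Set (ℝ × ℝ)} {e f : ℝ × ℝ} {a b d : ℝ × ℝ → ℂ}
    (hr : WeakRel Ω e f a b d)
    (ha : MemLp a 2 volume) (hb : MemLp b 2 volume) (hd : MemLp d 2 volume)
    (η : ContDiffBump (0 : ℝ × ℝ)) {z : ℝ × ℝ} (hz : Metric.closedBall z η.rOut ⊆ Ω) :
    fderiv ℝ (moll η a) z e + fderiv ℝ (moll η b) z f = moll η d z := by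
  have hφ := isTestFunction_bump η hz
  have key := hr _ hφ
  have hd' : ∀ y v, fderiv ℝ (fun y => (η.normed volume (z - y) : ℂ)) y v =
      -(fderiv ℝ (η.normed volume) (z - y) v : ℂ) := by
    intro y v
    have h1 : HasFDerivAt (η.normed volume) (fderiv ℝ (η.normed volume) (z - y)) (z - y) :=
      ((η.contDiff_normed (n := 1)).differentiable (by simp) _).hasFDerivAt
    have h2 := h1.comp y ((hasFDerivAt_id y).const_sub z)
    have h3 := (Complex.ofRealCLM.hasFDerivAt (x := η.normed volume (z - y))).comp y h2
    have h4 := h3.fderiv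
    have : fderiv ℝ (fun y => (η.normed volume (z - y) : ℂ)) y v = _ :=
      congrArg (fun L => L v) h4
    rw [this]; simp
  have i1 := integrable_mul_of_memLp_two ha (hφ.memLp_fderiv e)
  have i2 := integrable_mul_of_memLp_two hb (hφ.memLp_fderiv f)
  have i3 := integrable_mul_of_memLp_two hd hφ.memLp
  rw [integral_add (f := fun y => a y * _ + b y * _) (i1.add i2) i3, integral_add i1 i2] at key
  rw [fderiv_moll η ha, fderiv_moll η hb, moll_apply]
  simp only [hd', Complex.real_smul, mul_neg, integral_neg] at key ⊢
  simp only [mul_comm (a _), mul_comm (b _), mul_comm (d _)] at key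
  linear_combination -key


/-! ### $L^2$ bounds for averages over translations: mollifications and difference quotients. -/

lemma sq_lintegral_le {α : Type*} [MeasurableSpace α] (μ : Measure α) {f : α → ℝ≥0∞}
    (hf : AEMeasurable f μ) : (∫⁻ x, f x ∂μ) ^ 2 ≤ μ univ * ∫⁻ x, f x ^ 2 ∂μ := by
  have h := ENNReal.lintegral_mul_le_Lp_mul_Lq μ Real.HolderConjugate.two_two hf
    (aemeasurable_const (b := (1 : ℝ≥0∞)))
  simp only [Pi.mul_apply, mul_one, lintegral_const, one_pow, one_mul,
    ENNReal.rpow_two] at h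
  have h2 : ∀ x : ℝ≥0∞, (x ^ (1 / 2 : ℝ)) ^ 2 = x := fun x => by
    rw [← ENNReal.rpow_two, ← ENNReal.rpow_mul]; norm_num
  calc (∫⁻ x, f x ∂μ) ^ 2
      ≤ ((∫⁻ x, f x ^ 2 ∂μ) ^ (1 / 2 : ℝ) * (μ univ) ^ (1 / 2 : ℝ)) ^ 2 := by gcongr
    _ = μ univ * ∫⁻ x, f x ^ 2 ∂μ := by rw [mul_pow, h2, h2, mul_comm]

/-- Averaging over translations by vectors of norm at most `s` is an `L²` contraction from
`ball c (ρ + s)` to `ball c ρ`. -/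
lemma lintegral_average_sq_le {ν : Measure (ℝ × ℝ)} [IsProbabilityMeasure ν] {s : ℝ}
    (hν : ∀ᵐ y ∂ν, ‖y‖ ≤ s) {g : ℝ × ℝ → ℂ} (hg : Measurable g) (c : ℝ × ℝ) (ρ : ℝ) :
    ∫⁻ z in Metric.ball c ρ, (∫⁻ y, ‖g (z - y)‖ₑ ∂ν) ^ 2 ≤
      ∫⁻ z in Metric.ball c (ρ + s), ‖g z‖ₑ ^ 2 := by
  have hm : Measurable fun p : (ℝ × ℝ) × (ℝ × ℝ) => ‖g (p.1 - p.2)‖ₑ ^ 2 := by fun_prop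
  calc ∫⁻ z in Metric.ball c ρ, (∫⁻ y, ‖g (z - y)‖ₑ ∂ν) ^ 2
      ≤ ∫⁻ z in Metric.ball c ρ, ∫⁻ y, ‖g (z - y)‖ₑ ^ 2 ∂ν := by
        -- Cauchy–Schwarz for a probability measure; Tonelli and translation invariance of Lebesgue
        -- measure then do the rest.
        refine lintegral_mono fun z => ?_
        have := sq_lintegral_le ν (f := fun y => ‖g (z - y)‖ₑ) (by fun_prop)
        simpa using this
    _ = ∫⁻ y, (∫⁻ z in Metric.ball c ρ, ‖g (z - y)‖ₑ ^ 2) ∂ν :=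
        lintegral_lintegral_swap hm.aemeasurable
    _ ≤ ∫⁻ _, (∫⁻ z in Metric.ball c (ρ + s), ‖g z‖ₑ ^ 2) ∂ν := by
        refine lintegral_mono_ae ?_
        filter_upwards [hν] with y hy
        have h1 : MeasurePreserving (fun z : ℝ × ℝ => z - y) volume volume :=
          measurePreserving_sub_right volume y
        rw [← (h1.setLIntegral_comp_preimage (Metric.isOpen_ball.measurableSet)
          (f := fun z => ‖g z‖ₑ ^ 2) (by fun_prop))]
        refine lintegral_mono_set fun z hz => ?_
        rw [mem_preimage, mem_ball_iff_norm] at *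
        calc ‖z - y - c‖ = ‖(z - c) - y‖ := by congr 1; abel
          _ ≤ ‖z - c‖ + ‖y‖ := norm_sub_le _ _
          _ < ρ + s := by linarith
    _ = _ := by simp

/-- The probability measure with density a normalised bump function. -/
noncomputable def bumpMeasure (η : ContDiffBump (0 : ℝ × ℝ)) : Measure (ℝ × ℝ) :=
  volume.withDensity fun y => ENNReal.ofReal (η.normed volume y)

lemma measurable_bump (η : ContDiffBump (0 : ℝ × ℝ)) :
    Measurable fun y => ENNReal.ofReal (η.normed volume y) :=
  η.continuous_normed.measurable.ennreal_ofReal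

instance (η : ContDiffBump (0 : ℝ × ℝ)) : IsProbabilityMeasure (bumpMeasure η) := by
  constructor
  rw [bumpMeasure, withDensity_apply _ MeasurableSet.univ, Measure.restrict_univ,
    ← ofReal_integral_eq_lintegral_ofReal η.integrable_normed
      (Eventually.of_forall η.nonneg_normed), η.integral_normed, ENNReal.ofReal_one]

lemma bumpMeasure_norm_le (η : ContDiffBump (0 : ℝ × ℝ)) {s : ℝ} (hs : η.rOut ≤ s) :
    ∀ᵐ y ∂(bumpMeasure η), ‖y‖ ≤ s := by
  rw [bumpMeasure, ae_withDensity_iff (measurable_bump η)]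
  refine Eventually.of_forall fun y hy => ?_
  by_contra hlt
  have : y ∉ Function.support (η.normed volume) := by
    rw [η.support_normed_eq, mem_ball_zero_iff]; linarith
  rw [Function.notMem_support] at this
  simp [this] at hy

/-- A mollification is an average over translations against `bumpMeasure`, so
`lintegral_average_sq_le` applies to it. -/
lemma enorm_moll_le (η : ContDiffBump (0 : ℝ × ℝ)) {g : ℝ × ℝ → ℂ} (hg : Measurable g)
    (z : ℝ × ℝ) : ‖moll η g z‖ₑ ≤ ∫⁻ y, ‖g (z - y)‖ₑ ∂(bumpMeasure η) := by
  rw [moll_apply', bumpMeasure, lintegral_withDensity_eq_lintegral_mul _ (measurable_bump η)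
    (by fun_prop)]
  refine (enorm_integral_le_lintegral_enorm _).trans (lintegral_mono fun y => ?_)
  rw [enorm_smul, Pi.mul_apply, Real.enorm_of_nonneg (η.nonneg_normed y)]

lemma moll_congr (η : ContDiffBump (0 : ℝ × ℝ)) {f g : ℝ × ℝ → ℂ} (h : f =ᵐ[volume] g) :
    moll η f = moll η g := by
  ext z
  rw [moll_apply, moll_apply]
  refine integral_congr_ae ?_
  filter_upwards [h] with y hy
  rw [hy]

/-- Young's inequality for mollification. -/
lemma lintegral_moll_sq_le (η : ContDiffBump (0 : ℝ × ℝ)) {s : ℝ} (hs : η.rOut ≤ s)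
    {g : ℝ × ℝ → ℂ} (hg : MemLp g 2 volume) (c : ℝ × ℝ) (ρ : ℝ) :
    ∫⁻ z in Metric.ball c ρ, ‖moll η g z‖ₑ ^ 2 ≤
      ∫⁻ z in Metric.ball c (ρ + s), ‖g z‖ₑ ^ 2 := by
  have hae := hg.1.ae_eq_mk
  have hm := hg.1.stronglyMeasurable_mk.measurable
  rw [moll_congr η hae]
  calc _ ≤ ∫⁻ z in Metric.ball c ρ, (∫⁻ y, ‖hg.1.mk g (z - y)‖ₑ ∂(bumpMeasure η)) ^ 2 := by
        gcongr with z; exact enorm_moll_le η hm z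
    _ ≤ ∫⁻ z in Metric.ball c (ρ + s), ‖hg.1.mk g z‖ₑ ^ 2 :=
        lintegral_average_sq_le (bumpMeasure_norm_le η hs) hm c ρ
    _ = _ := by
        refine lintegral_congr_ae ?_
        filter_upwards [ae_restrict_of_ae hae] with z hz
        rw [hz]

/-- The uniform probability measure on the segment from `0` to `(-h, 0)`. -/
noncomputable def segMeasure (h : ℝ) : Measure (ℝ × ℝ) :=
  (volume.restrict (Ioc (0 : ℝ) 1)).map fun θ => (-(θ * h), 0)

instance (h : ℝ) : IsProbabilityMeasure (segMeasure h) := by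
  have : IsProbabilityMeasure (volume.restrict (Ioc (0 : ℝ) 1)) := ⟨by simp⟩
  exact Measure.isProbabilityMeasure_map (by fun_prop)

lemma segMeasure_norm_le {h s : ℝ} (hs : |h| ≤ s) : ∀ᵐ y ∂(segMeasure h), ‖y‖ ≤ s := by
  rw [segMeasure, ae_map_iff (by fun_prop) (measurableSet_le (by fun_prop) (by fun_prop))]
  filter_upwards [ae_restrict_mem measurableSet_Ioc] with θ hθ
  rw [norm_prod_zero, abs_neg, abs_mul, abs_of_pos hθ.1]
  exact (mul_le_of_le_one_left (abs_nonneg h) hθ.2).trans hs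

/-- By the fundamental theorem of calculus the difference quotient is the mean of $\partial_t u$
over the segment from $z$ to $z+(h,0)$. The sign in `segMeasure` turns $z-y$ into a point of this
segment. For $h=0$ the convention $0^{-1}=0$ makes the quotient vanish. -/
lemma enorm_dq_le {u : ℝ × ℝ → ℂ} (hu : ContDiff ℝ 1 u) (h : ℝ) (z : ℝ × ℝ) :
    ‖dq h u z‖ₑ ≤ ∫⁻ y, ‖fderiv ℝ u (z - y) (1, 0)‖ₑ ∂(segMeasure h) := by
  rcases eq_or_ne h 0 with rfl | h0
  · simp [dq]
  have hc : Continuous fun w => fderiv ℝ u w (1, 0) :=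
    (hu.continuous_fderiv (by simp)).clm_apply continuous_const
  have hd : ∀ θ ∈ uIcc (0 : ℝ) 1, HasDerivAt (fun θ : ℝ => u (z + (θ * h, 0)))
      ((h : ℂ) * fderiv ℝ u (z + (θ * h, 0)) (1, 0)) θ := by
    intro θ _
    have h1 : HasDerivAt (fun θ : ℝ => z + ((θ * h, 0) : ℝ × ℝ)) (h, 0) θ := by
      have : HasDerivAt (fun θ : ℝ => ((θ * h, 0) : ℝ × ℝ)) (1 * h, 0) θ :=
        ((hasDerivAt_id θ).mul_const h).prodMk (hasDerivAt_const θ 0)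
      simpa using this.const_add z
    have h2 := ((hu.differentiable (by simp) (z + (θ * h, 0))).hasFDerivAt).comp_hasDerivAt θ h1
    have : ((h, 0) : ℝ × ℝ) = h • (1, 0) := by simp
    rw [this, map_smul, Complex.real_smul] at h2
    exact h2
  have hint := intervalIntegral.integral_eq_sub_of_hasDerivAt hd
    (Continuous.intervalIntegrable (by fun_prop) _ _)
  rw [intervalIntegral.integral_const_mul] at hint
  have hz : z + ((0 * h, 0) : ℝ × ℝ) = z := by simp
  rw [hz, one_mul] at hint
  have hq : dq h u z = ∫ θ in (0 : ℝ)..1, fderiv ℝ u (z + (θ * h, 0)) (1, 0) := by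
    rw [dq, ← hint, inv_mul_cancel_left₀ (by exact_mod_cast h0)]
  rw [hq, intervalIntegral.integral_of_le zero_le_one, segMeasure,
    lintegral_map (by fun_prop) (by fun_prop)]
  refine (enorm_integral_le_lintegral_enorm _).trans (le_of_eq ?_)
  refine lintegral_congr fun θ => ?_
  congr 3
  ext <;> simp

/-- Difference quotients of a smooth function are controlled by its derivative. -/
lemma lintegral_dq_sq_le_of_contDiff {u : ℝ × ℝ → ℂ} (hu : ContDiff ℝ 1 u) {h s : ℝ}
    (hs : |h| ≤ s) (c : ℝ × ℝ) (ρ : ℝ) :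
    ∫⁻ z in Metric.ball c ρ, ‖dq h u z‖ₑ ^ 2 ≤
      ∫⁻ z in Metric.ball c (ρ + s), ‖fderiv ℝ u z (1, 0)‖ₑ ^ 2 := by
  have hc : Continuous fun w => fderiv ℝ u w (1, 0) :=
    (hu.continuous_fderiv (by simp)).clm_apply continuous_const
  calc _ ≤ ∫⁻ z in Metric.ball c ρ,
        (∫⁻ y, ‖fderiv ℝ u (z - y) (1, 0)‖ₑ ∂(segMeasure h)) ^ 2 := by
        gcongr with z; exact enorm_dq_le hu h z
    _ ≤ _ := lintegral_average_sq_le (segMeasure_norm_le hs) hc.measurable c ρ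

/-- A sequence of bump functions shrinking to the origin. -/
noncomputable def bumpSeq (n : ℕ) : ContDiffBump (0 : ℝ × ℝ) :=
  ⟨1 / (n + 1) / 2, 1 / (n + 1), by positivity, half_lt_self (by positivity)⟩

lemma tendsto_bumpSeq_rOut : Tendsto (fun n => (bumpSeq n).rOut) atTop (𝓝 0) :=
  tendsto_one_div_add_atTop_nhds_zero_nat

lemma eventually_bumpSeq_le {s : ℝ} (hs : 0 < s) : ∀ᶠ n in atTop, (bumpSeq n).rOut ≤ s :=
  (tendsto_bumpSeq_rOut.eventually_lt_const hs).mono fun _ h => h.le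

lemma ae_tendsto_moll {a : ℝ × ℝ → ℂ} (ha : MemLp a 2 volume) :
    ∀ᵐ z, Tendsto (fun n => moll (bumpSeq n) a z) atTop (𝓝 (a z)) :=
  -- The outer radius is exactly twice the inner one, which gives the bounded ratio needed for
  -- Lebesgue differentiation.
  ContDiffBump.ae_convolution_tendsto_right_of_locallyIntegrable (K := 2) tendsto_bumpSeq_rOut
    (Eventually.of_forall fun n => by simp [bumpSeq]; linarith)
    (locallyIntegrable_of_memLp_two ha)

/-- Fatou's lemma for a sequence of functions bounded in `L²(S)`. -/
lemma lintegral_sq_le_of_tendsto {S : Set (ℝ × ℝ)} {u : ℕ → ℝ × ℝ → ℂ} {v : ℝ × ℝ → ℂ}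
    (hu : ∀ n, AEMeasurable (u n) (volume.restrict S))
    (hlim : ∀ᵐ z ∂(volume.restrict S), Tendsto (fun n => u n z) atTop (𝓝 (v z)))
    {B : ℝ≥0∞} (hB : ∀ᶠ n in atTop, ∫⁻ z in S, ‖u n z‖ₑ ^ 2 ≤ B) :
    ∫⁻ z in S, ‖v z‖ₑ ^ 2 ≤ B := by
  calc ∫⁻ z in S, ‖v z‖ₑ ^ 2 = ∫⁻ z in S, liminf (fun n => ‖u n z‖ₑ ^ 2) atTop := by
        refine lintegral_congr_ae ?_
        filter_upwards [hlim] with z hz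
        exact ((ENNReal.continuous_pow 2).tendsto _ |>.comp hz.enorm).liminf_eq.symm
    _ ≤ liminf (fun n => ∫⁻ z in S, ‖u n z‖ₑ ^ 2) atTop :=
        lintegral_liminf_le' fun n => (hu n).enorm.pow_const 2
    _ ≤ B := liminf_le_of_frequently_le' hB.frequently

/-- Difference quotients are controlled by the weak derivative. -/
lemma WeakRel.lintegral_dq_sq_le {c : ℝ × ℝ} {ρ s : ℝ} {f : ℝ × ℝ} {U G : ℝ × ℝ → ℂ}
    (hr : WeakRel (Metric.ball c (ρ + 2 * s)) (1, 0) f U 0 G) (hU : MemLp U 2 volume)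
    (hG : MemLp G 2 volume) {h : ℝ} (hs : |h| ≤ s) (hs0 : 0 < s) :
    ∫⁻ z in Metric.ball c ρ, ‖dq h U z‖ₑ ^ 2 ≤
      ∫⁻ z in Metric.ball c (ρ + 2 * s), ‖G z‖ₑ ^ 2 := by
  have hlim : ∀ᵐ z, Tendsto (fun n => dq h (moll (bumpSeq n) U) z) atTop (𝓝 (dq h U z)) := by
    have h1 := ae_tendsto_moll hU
    have h2 := (measurePreserving_add_right volume ((h, 0) : ℝ × ℝ)).quasiMeasurePreserving.ae h1
    filter_upwards [h1, h2] with z hz1 hz2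
    exact (hz2.sub hz1).const_mul _
  refine lintegral_sq_le_of_tendsto (fun n => ?_) (ae_restrict_of_ae hlim) ?_
  · have := (contDiff_moll (bumpSeq n) hU).continuous
    unfold dq
    fun_prop
  -- The margin $2s$ is spent in two halves: one $s$ for the increment $h$, one for the
  -- mollification radius.
  · filter_upwards [eventually_bumpSeq_le hs0] with n hn
    have hsm := contDiff_moll (bumpSeq n) hU
    refine (lintegral_dq_sq_le_of_contDiff (hsm.of_le (by simp)) hs c ρ).trans ?_
    have : ∫⁻ z in Metric.ball c (ρ + s), ‖fderiv ℝ (moll (bumpSeq n) U) z (1, 0)‖ₑ ^ 2 =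
        ∫⁻ z in Metric.ball c (ρ + s), ‖moll (bumpSeq n) G z‖ₑ ^ 2 := by
      refine setLIntegral_congr_fun Metric.isOpen_ball.measurableSet fun z hz => ?_
      have hz' : Metric.closedBall z (bumpSeq n).rOut ⊆ Metric.ball c (ρ + 2 * s) := by
        refine Metric.closedBall_subset_ball' ?_
        rw [Metric.mem_ball] at hz
        linarith
      have := hr.mollify hU MemLp.zero hG (bumpSeq n) hz'
      have h0 : moll (bumpSeq n) 0 = fun _ => 0 := by ext; simp [moll_apply]
      rw [h0] at this
      simp only [fderiv_fun_const, Pi.zero_apply, _root_.zero_apply,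
        add_zero] at this
      simp only [this]
    rw [this]
    have := lintegral_moll_sq_le (bumpSeq n) hn hG c (ρ + s)
    rwa [add_assoc, ← two_mul] at this


/-! ### Weak $L^2$ convergence of mollifications and the div–curl pairing. -/

/-- Translation acts continuously on $L^2$, and the integral is an inner product with the conjugate
of $H$. -/
lemma continuous_integral_mul_translate {H F : ℝ × ℝ → ℂ} (hH : MemLp H 2 volume)
    (hF : MemLp F 2 volume) : Continuous fun y => ∫ z, H z * F (z + y) := by
  let g : C(ℝ × ℝ, C(ℝ × ℝ, ℝ × ℝ)) :=
    (ContinuousMap.mk (fun p : (ℝ × ℝ) × (ℝ × ℝ) => p.2 + p.1) (by fun_prop)).curry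
  have hg : ∀ y, MeasurePreserving (g y) volume volume := fun y =>
    measurePreserving_add_right volume y
  have hcont := (continuous_const (y := hF.toLp F)).compMeasurePreservingLp g.continuous hg
    (by norm_num)
  have hin := (continuous_const (y := hH.star.toLp (star H))).inner (𝕜 := ℂ) hcont
  refine hin.congr fun y => ?_
  rw [L2.inner_def]
  refine integral_congr_ae ?_
  have h1 := Lp.coeFn_compMeasurePreserving (hF.toLp F) (hg y)
  have h2 := (hg y).quasiMeasurePreserving.ae hF.coeFn_toLp
  filter_upwards [hH.star.coeFn_toLp, h1, h2] with z hz1 hz2 hz3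
  rw [hz1, hz2, Function.comp_apply, hz3]
  simp [mul_comm, g]

/-- Fubini moves the mollifier onto the correlation function of $H$ and $F$. That function is
continuous, so its mollifications at $0$ converge, which yields weak convergence. -/
lemma integral_mul_moll (η : ContDiffBump (0 : ℝ × ℝ)) {H F : ℝ × ℝ → ℂ}
    (hH : MemLp H 2 volume) (hF : MemLp F 2 volume) :
    ∫ z, H z * moll η F z = moll η (fun y => ∫ z, H z * F (z + y)) 0 := by
  have hint : Integrable (fun p : (ℝ × ℝ) × (ℝ × ℝ) =>
      H p.1 * (η.normed volume p.2 • F (p.1 - p.2))) (volume.prod volume) := by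
    have hη : Integrable (η.normed volume) (volume : Measure (ℝ × ℝ)) := η.integrable_normed
    have h1 := (hH.integrable_norm_pow (by norm_num)).mul_prod hη
    have h2 := hη.convolution_integrand (ContinuousLinearMap.lsmul ℝ ℝ)
      (hF.integrable_norm_pow (by norm_num))
    refine (h1.add h2).mono' ?_ (Eventually.of_forall fun p => ?_)
    · refine hH.1.comp_fst.mul ((hη.1.comp_snd).smul ?_)
      exact hF.1.comp_quasiMeasurePreserving (quasiMeasurePreserving_sub_of_right_invariant _ _)
    · have h0 := η.nonneg_normed (μ := volume) p.2
      simp only [norm_mul, norm_smul, Real.norm_of_nonneg h0, Pi.add_apply,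
        ContinuousLinearMap.lsmul_apply, smul_eq_mul]
      have : ‖H p.1‖ * ‖F (p.1 - p.2)‖ ≤ ‖H p.1‖ ^ 2 + ‖F (p.1 - p.2)‖ ^ 2 := by
        nlinarith [sq_nonneg (‖H p.1‖ - ‖F (p.1 - p.2)‖), norm_nonneg (H p.1),
          norm_nonneg (F (p.1 - p.2))]
      nlinarith [mul_le_mul_of_nonneg_left this h0]
  calc ∫ z, H z * moll η F z = ∫ z, ∫ y, H z * (η.normed volume y • F (z - y)) := by
        congr 1; ext z; rw [moll_apply', integral_const_mul]
    _ = ∫ y, ∫ z, H z * (η.normed volume y • F (z - y)) := integral_integral_swap hint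
    _ = _ := by
        rw [moll_apply']
        congr 1; ext y
        rw [← integral_smul]
        congr 1; ext z
        simp only [Complex.real_smul, zero_sub, ← sub_eq_add_neg]
        ring

/-- Mollification converges weakly in `L²`. -/
lemma tendsto_integral_mul_moll {H F : ℝ × ℝ → ℂ} (hH : MemLp H 2 volume)
    (hF : MemLp F 2 volume) :
    Tendsto (fun n => ∫ z, H z * moll (bumpSeq n) F z) atTop (𝓝 (∫ z, H z * F z)) := by
  simp only [integral_mul_moll _ hH hF]
  have := ContDiffBump.convolution_tendsto_right_of_continuous (μ := volume)
    tendsto_bumpSeq_rOut (continuous_integral_mul_translate hH hF) 0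
  simpa only [moll, add_zero] using this

lemma memLp_mul_of_hasCompactSupport {φ a : ℝ × ℝ → ℂ}
    (hφ : Continuous φ) (hc : HasCompactSupport φ) (ha : MemLp a 2 volume) :
    MemLp (fun z => a z * φ z) 2 volume :=
  (hφ.memLp_of_hasCompactSupport hc (p := ⊤)).mul ha

lemma IsTestFunction.mul_left {Ω : Set (ℝ × ℝ)} {χ u : ℝ × ℝ → ℂ} (hχ : IsTestFunction Ω χ)
    (hu : ContDiff ℝ ∞ u) : IsTestFunction Ω fun z => u z * χ z where
  smooth := hu.mul hχ.smooth
  compact := hχ.compact.mul_left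
  subset := (tsupport_mul_subset_right (f := u) (g := χ)).trans hχ.subset

/-- A divergence-free field paired with a localised weak gradient. -/
lemma integral_div_curl {Ω : Set (ℝ × ℝ)} (hΩ : IsOpen Ω) {U G₀ G₁ F₀ F₁ χ : ℝ × ℝ → ℂ}
    (hU : MemLp U 2 volume) (hG₀ : MemLp G₀ 2 volume) (hG₁ : MemLp G₁ 2 volume)
    (hF₀ : MemLp F₀ 2 volume) (hF₁ : MemLp F₁ 2 volume)
    (h₀ : WeakRel Ω (1, 0) 0 U 0 G₀) (h₁ : WeakRel Ω (0, 1) 0 U 0 G₁)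
    (hF : WeakRel Ω (1, 0) (0, 1) F₀ F₁ 0) (hχ : IsTestFunction Ω χ) :
    ∫ z, (χ z * (F₀ z * G₀ z + F₁ z * G₁ z) +
      U z * (F₀ z * fderiv ℝ χ z (1, 0) + F₁ z * fderiv ℝ χ z (0, 1))) = 0 := by
  have m0 := memLp_mul_of_hasCompactSupport hχ.smooth.continuous hχ.compact hG₀
  have m1 := memLp_mul_of_hasCompactSupport hχ.smooth.continuous hχ.compact hG₁
  have m2 := memLp_mul_of_hasCompactSupport (hχ.continuous_fderiv (1, 0))
    (hχ.compact.fderiv_apply ℝ _) hU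
  have m3 := memLp_mul_of_hasCompactSupport (hχ.continuous_fderiv (0, 1))
    (hχ.compact.fderiv_apply ℝ _) hU
  have e0 := m0.add m2
  have e1 := m1.add m3
  obtain ⟨δ, hδ, hsub⟩ := hχ.compact.exists_cthickening_subset_open hΩ hχ.subset
  -- Only the field $F$ is mollified. Then $\chi F_\varepsilon$ is an admissible test function for
  -- the two gradient relations, and $\operatorname{div}F_\varepsilon=0$ on the support of $\chi$
  -- once $\varepsilon\le\delta$.
  have hz : ∀ᶠ n in atTop, (∫ z, (G₀ z * χ z + U z * fderiv ℝ χ z (1, 0)) *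
      moll (bumpSeq n) F₀ z) + (∫ z, (G₁ z * χ z + U z * fderiv ℝ χ z (0, 1)) *
      moll (bumpSeq n) F₁ z) = 0 := by
    filter_upwards [eventually_bumpSeq_le hδ] with n hn
    have s0 := contDiff_moll (bumpSeq n) hF₀
    have s1 := contDiff_moll (bumpSeq n) hF₁
    have t0 := hχ.mul_left s0
    have t1 := hχ.mul_left s1
    have r0 := h₀ _ t0
    have r1 := h₁ _ t1
    have d : ∀ (u : ℝ × ℝ → ℂ), ContDiff ℝ ∞ u → ∀ z e, fderiv ℝ (fun z => u z * χ z) z e =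
        u z * fderiv ℝ χ z e + χ z * fderiv ℝ u z e := by
      intro u hu z e
      rw [fderiv_fun_mul (hu.differentiable (by simp) z) (hχ.smooth.differentiable (by simp) z)]
      simp
    have i0 := integrable_weakRel t0 (1, 0) 0 hU MemLp.zero hG₀
    have i1 := integrable_weakRel t1 (0, 1) 0 hU MemLp.zero hG₁
    have hdiv : ∀ z, χ z * (fderiv ℝ (moll (bumpSeq n) F₀) z (1, 0) +
        fderiv ℝ (moll (bumpSeq n) F₁) z (0, 1)) = 0 := by
      intro z
      by_cases hz : z ∈ tsupport χ
      · have := hF.mollify hF₀ hF₁ MemLp.zero (bumpSeq n) (z := z)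
          ((Metric.closedBall_subset_closedBall hn).trans
            ((Metric.closedBall_subset_cthickening hz δ).trans hsub))
        rw [this]; simp [moll_apply]
      · rw [image_eq_zero_of_notMem_tsupport hz, zero_mul]
    have l0 : Integrable (fun z => (G₀ z * χ z + U z * fderiv ℝ χ z (1, 0)) *
        moll (bumpSeq n) F₀ z) := by
      have a1 := integrable_mul_of_memLp_two hG₀ t0.memLp
      have a2 := integrable_mul_of_memLp_two hU
        (((s0.continuous.mul (hχ.continuous_fderiv (1, 0)))).memLp_of_hasCompactSupport
          ((hχ.compact.fderiv_apply ℝ (1, 0)).mul_left))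
      refine (a1.add a2).congr (Eventually.of_forall fun z => ?_)
      simp only [Pi.add_apply, Pi.mul_apply]; ring
    have l1 : Integrable (fun z => (G₁ z * χ z + U z * fderiv ℝ χ z (0, 1)) *
        moll (bumpSeq n) F₁ z) := by
      have a1 := integrable_mul_of_memLp_two hG₁ t1.memLp
      have a2 := integrable_mul_of_memLp_two hU
        (((s1.continuous.mul (hχ.continuous_fderiv (0, 1)))).memLp_of_hasCompactSupport
          ((hχ.compact.fderiv_apply ℝ (0, 1)).mul_left))
      refine (a1.add a2).congr (Eventually.of_forall fun z => ?_)
      simp only [Pi.add_apply, Pi.mul_apply]; ring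
    rw [← integral_add l0 l1]
    have hs := integral_add i0 i1
    rw [r0, r1, add_zero] at hs
    rw [← hs]
    congr 1; ext z
    rw [d _ s0, d _ s1]
    simp only [Pi.zero_apply]
    linear_combination -(U z) * hdiv z
  -- The factors paired with $F_\varepsilon$ are fixed $L^2$ functions, so weak convergence suffices
  -- for the limit.
  have l0 := tendsto_integral_mul_moll e0 hF₀
  have l1 := tendsto_integral_mul_moll e1 hF₁
  have hl := (l0.add l1).congr' hz
  have := tendsto_nhds_unique hl tendsto_const_nhds
  rw [← integral_add (integrable_mul_of_memLp_two e0 hF₀)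
    (integrable_mul_of_memLp_two e1 hF₁)] at this
  rw [← this]
  congr 1; ext z
  simp only [Pi.add_apply]; ring


/-! ### Cutoff functions and Caccioppoli's inequality. -/

lemma exists_deriv_smoothTransition_le : ∃ K : ℝ, 0 < K ∧
    ∀ x, |deriv Real.smoothTransition x| ≤ K := by
  have hc : Continuous (deriv Real.smoothTransition) :=
    (Real.smoothTransition.contDiff (n := 1)).continuous_deriv le_rfl
  have hs : HasCompactSupport (deriv Real.smoothTransition) := by
    refine HasCompactSupport.of_support_subset_isCompact (isCompact_Icc (a := (0 : ℝ)) (b := 1)) ?_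
    intro x hx
    by_contra hn
    apply hx
    rw [mem_Icc, not_and_or, not_le, not_le] at hn
    rcases hn with h | h
    · have : Real.smoothTransition =ᶠ[𝓝 x] fun _ => 0 := by
        filter_upwards [Iio_mem_nhds h] with y hy
        exact Real.smoothTransition.zero_of_nonpos (le_of_lt hy)
      rw [this.deriv_eq, deriv_const]
    · have : Real.smoothTransition =ᶠ[𝓝 x] fun _ => 1 := by
        filter_upwards [Ioi_mem_nhds h] with y hy
        exact Real.smoothTransition.one_of_one_le (le_of_lt hy)
      rw [this.deriv_eq, deriv_const]
  obtain ⟨K, hK⟩ := hs.exists_bound_of_continuous hc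
  exact ⟨|K| + 1, by positivity, fun x => by
    have := hK x
    rw [Real.norm_eq_abs] at this
    linarith [le_abs_self K]⟩

/-- One-dimensional cutoff functions with a scale-invariant derivative bound. -/
lemma exists_cutoff_real : ∃ K : ℝ, 0 < K ∧ ∀ (ρ s : ℝ), 0 < s → ∃ θ : ℝ → ℝ,
    ContDiff ℝ ∞ θ ∧ (∀ t, 0 ≤ θ t) ∧ (∀ t, θ t ≤ 1) ∧ (∀ t, |t| ≤ ρ → θ t = 1) ∧
    (∀ t, ρ + s / 2 ≤ |t| → θ t = 0) ∧ ∀ t, |deriv θ t| ≤ K / s := by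
  obtain ⟨K, hK, hb⟩ := exists_deriv_smoothTransition_le
  refine ⟨4 * K, by positivity, fun ρ s hs => ?_⟩
  -- Slope $2/s$ fits the unit transition into a collar of width $s/2$; the remaining $s/2$ keeps
  -- the closed support inside the open ball of radius $\rho+s$. The two factors contribute
  -- $Ka=2K/s$ each to the derivative, hence $4K$.
  set a : ℝ := 2 / s
  set b : ℝ := ρ + s / 2
  have ha : 0 < a := by positivity
  have has : a * (s / 2) = 1 := by simp only [a]; field_simp
  have h0 := Real.smoothTransition.nonneg
  have h1 := Real.smoothTransition.le_one
  refine ⟨fun t => Real.smoothTransition (a * (b - t)) * Real.smoothTransition (a * (b + t)),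
    ?_, fun t => mul_nonneg (h0 _) (h0 _), fun t => mul_le_one₀ (h1 _) (h0 _) (h1 _), ?_, ?_, ?_⟩
  · exact (Real.smoothTransition.contDiff.comp (by fun_prop)).mul
      (Real.smoothTransition.contDiff.comp (by fun_prop))
  · intro t ht
    rw [abs_le] at ht
    beta_reduce
    rw [Real.smoothTransition.one_of_one_le, Real.smoothTransition.one_of_one_le, one_mul]
    · rw [← has]; exact mul_le_mul_of_nonneg_left (by simp only [b]; linarith) ha.le
    · rw [← has]; exact mul_le_mul_of_nonneg_left (by simp only [b]; linarith) ha.le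
  · intro t ht
    beta_reduce
    rcases le_abs.1 ht with h | h
    · rw [Real.smoothTransition.zero_of_nonpos (x := a * (b - t))
        (mul_nonpos_of_nonneg_of_nonpos ha.le (by linarith)), zero_mul]
    · rw [Real.smoothTransition.zero_of_nonpos (x := a * (b + t))
        (mul_nonpos_of_nonneg_of_nonpos ha.le (by linarith)), mul_zero]
  · intro t
    have hd : ∀ x, HasDerivAt Real.smoothTransition (deriv Real.smoothTransition x) x := fun x =>
      ((Real.smoothTransition.contDiff (n := 1)).differentiable (by simp) x).hasDerivAt
    have d1 : HasDerivAt (fun t => a * (b - t)) (-a) t := by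
      simpa using ((hasDerivAt_id t).const_sub b).const_mul a
    have d2 : HasDerivAt (fun t => a * (b + t)) a t := by
      simpa using ((hasDerivAt_id t).const_add b).const_mul a
    have := (((hd _).comp t d1).mul ((hd _).comp t d2)).deriv
    erw [this]
    have e1 : |deriv Real.smoothTransition (a * (b - t)) * -a *
        Real.smoothTransition (a * (b + t))| ≤ K * a * 1 := by
      rw [abs_mul, abs_mul, abs_neg, abs_of_pos ha, abs_of_nonneg (h0 _)]
      exact mul_le_mul (mul_le_mul_of_nonneg_right (hb _) ha.le) (h1 _) (h0 _) (by positivity)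
    have e2 : |Real.smoothTransition (a * (b - t)) *
        (deriv Real.smoothTransition (a * (b + t)) * a)| ≤ 1 * (K * a) := by
      rw [abs_mul, abs_mul, abs_of_pos ha, abs_of_nonneg (h0 _)]
      exact mul_le_mul (h1 _) (mul_le_mul_of_nonneg_right (hb _) ha.le) (by positivity) zero_le_one
    calc _ ≤ K * a * 1 + 1 * (K * a) := (abs_add_le _ _).trans (add_le_add e1 e2)
      _ = 4 * K / s := by simp only [a]; ring

/-- Cutoff functions between concentric cubes. -/
lemma exists_cutoff : ∃ K : ℝ, 0 < K ∧ ∀ (c : ℝ × ℝ) (ρ s : ℝ), 0 < s → ∃ χ : ℝ × ℝ → ℝ,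
    ContDiff ℝ ∞ χ ∧ HasCompactSupport χ ∧ tsupport χ ⊆ Metric.ball c (ρ + s) ∧
    (∀ z, 0 ≤ χ z) ∧ (∀ z, χ z ≤ 1) ∧ (∀ z ∈ Metric.ball c ρ, χ z = 1) ∧
    (∀ z, |fderiv ℝ χ z (1, 0)| ≤ K / s) ∧ ∀ z, |fderiv ℝ χ z (0, 1)| ≤ K / s := by
  obtain ⟨K, hK, h⟩ := exists_cutoff_real
  refine ⟨K, hK, fun c ρ s hs => ?_⟩
  obtain ⟨θ, hsm, h0, h1, hone, hzero, hder⟩ := h ρ s hs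
  have hsupp : Function.support (fun z : ℝ × ℝ => θ (z.1 - c.1) * θ (z.2 - c.2)) ⊆
      Metric.closedBall c (ρ + s / 2) := by
    intro z hz
    rw [mem_closedBall_iff_norm, Prod.norm_def, max_le_iff]
    constructor
    · by_contra! hn
      exact hz (by simp only [hzero (z.1 - c.1) hn.le, zero_mul])
    · by_contra! hn
      exact hz (by simp only [hzero (z.2 - c.2) hn.le, mul_zero])
  have hfd : ∀ z : ℝ × ℝ, HasFDerivAt (fun z : ℝ × ℝ => θ (z.1 - c.1) * θ (z.2 - c.2))
      (θ (z.1 - c.1) • (deriv θ (z.2 - c.2) • ContinuousLinearMap.snd ℝ ℝ ℝ) +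
        θ (z.2 - c.2) • (deriv θ (z.1 - c.1) • ContinuousLinearMap.fst ℝ ℝ ℝ)) z := by
    intro z
    have d : ∀ t, HasDerivAt θ (deriv θ t) t := fun t =>
      (hsm.differentiable (by simp) t).hasDerivAt
    have f1 : HasFDerivAt (fun z : ℝ × ℝ => z.1 - c.1) (ContinuousLinearMap.fst ℝ ℝ ℝ) z :=
      hasFDerivAt_fst.sub_const c.1
    have f2 : HasFDerivAt (fun z : ℝ × ℝ => z.2 - c.2) (ContinuousLinearMap.snd ℝ ℝ ℝ) z :=
      hasFDerivAt_snd.sub_const c.2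
    exact ((d _).comp_hasFDerivAt z f1).mul ((d _).comp_hasFDerivAt z f2)
  have hKs : 0 ≤ K / s := by positivity
  refine ⟨fun z => θ (z.1 - c.1) * θ (z.2 - c.2), ?_, ?_, ?_, fun z => mul_nonneg (h0 _) (h0 _),
    fun z => mul_le_one₀ (h1 _) (h0 _) (h1 _), ?_, ?_, ?_⟩
  · exact (hsm.comp (contDiff_fst.sub contDiff_const)).mul
      (hsm.comp (contDiff_snd.sub contDiff_const))
  · exact HasCompactSupport.of_support_subset_isCompact (isCompact_closedBall c (ρ + s / 2)) hsupp
  · exact (closure_minimal hsupp Metric.isClosed_closedBall).trans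
      (Metric.closedBall_subset_ball (by linarith))
  · intro z hz
    rw [mem_ball_iff_norm, Prod.norm_def, max_lt_iff] at hz
    beta_reduce
    rw [hone _ (by simpa using hz.1.le), hone _ (by simpa using hz.2.le), one_mul]
  · intro z
    rw [(hfd z).fderiv]
    simp only [_root_.add_apply, _root_.smul_apply,
      ContinuousLinearMap.coe_fst', ContinuousLinearMap.coe_snd', smul_eq_mul, mul_zero, mul_one,
      zero_add, abs_mul]
    rw [abs_of_nonneg (h0 _)]
    calc _ ≤ 1 * (K / s) := mul_le_mul (h1 _) (hder _) (abs_nonneg _) zero_le_one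
      _ = _ := one_mul _
  · intro z
    rw [(hfd z).fderiv]
    simp only [_root_.add_apply, _root_.smul_apply,
      ContinuousLinearMap.coe_fst', ContinuousLinearMap.coe_snd', smul_eq_mul, mul_zero, mul_one,
      add_zero, abs_mul]
    rw [abs_of_nonneg (h0 _)]
    calc _ ≤ 1 * (K / s) := mul_le_mul (h1 _) (hder _) (abs_nonneg _) zero_le_one
      _ = _ := one_mul _

lemma IsTestFunction.star {Ω : Set (ℝ × ℝ)} {φ : ℝ × ℝ → ℂ} (hφ : IsTestFunction Ω φ) :
    IsTestFunction Ω (fun z => star (φ z)) where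
  smooth := (starL' ℝ (A := ℂ)).contDiff.comp hφ.smooth
  compact := hφ.compact.comp_left (g := fun x : ℂ => Star.star x) (by simp)
  subset := (closure_mono (Function.support_subset_iff'.2 fun z hz => by
    simp [Function.notMem_support.1 hz])).trans hφ.subset

lemma WeakRel.star {Ω : Set (ℝ × ℝ)} {e f : ℝ × ℝ} {a b d : ℝ × ℝ → ℂ}
    (h : WeakRel Ω e f a b d) :
    WeakRel Ω e f (fun z => star (a z)) (fun z => star (b z)) (fun z => star (d z)) := by
  intro φ hφ
  have := congrArg (starRingEnd ℂ) (h _ hφ.star)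
  rw [← integral_conj, map_zero] at this
  rw [← this]
  have hd : ∀ z v, fderiv ℝ (fun z => Star.star (φ z)) z v = Star.star (fderiv ℝ φ z v) := by
    intro z v
    rw [fderiv_star]; rfl
  congr 1; ext z
  rw [hd, hd]
  simp

lemma lintegral_enorm_sq_eq {a : ℝ × ℝ → ℂ} (ha : MemLp a 2 volume) (S : Set (ℝ × ℝ)) :
    ∫⁻ z in S, ‖a z‖ₑ ^ 2 = ENNReal.ofReal (∫ z in S, ‖a z‖ ^ 2) := by
  have hi : Integrable (fun z => ‖a z‖ ^ 2) (volume.restrict S) :=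
    (ha.restrict S).integrable_norm_pow (by norm_num)
  rw [ofReal_integral_eq_lintegral_ofReal hi (Eventually.of_forall fun z => by positivity)]
  refine lintegral_congr fun z => ?_
  rw [ENNReal.ofReal_pow (norm_nonneg _), ofReal_norm]

/-- Pointwise form of Caccioppoli's inequality. -/
lemma caccioppoli_pointwise {lam m χ : ℝ} (hlam : 0 < lam) (hχ : 0 ≤ χ)
    {F₀ F₁ G₀ G₁ U d₀ d₁ : ℂ} {M k : ℝ} (hm : m = M * k)
    (hell : lam * (‖G₀‖ ^ 2 + ‖G₁‖ ^ 2) ≤ (F₀ * star G₀ + F₁ * star G₁).re)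
    (hF₀ : ‖F₀‖ ≤ M * (‖G₀‖ + ‖G₁‖)) (hF₁ : ‖F₁‖ ≤ M * (‖G₀‖ + ‖G₁‖))
    (hd₀ : ‖d₀‖ ≤ k) (hd₁ : ‖d₁‖ ≤ k) :
    lam / 2 * (χ ^ 2 * (‖G₀‖ ^ 2 + ‖G₁‖ ^ 2)) - 16 * m ^ 2 / lam * ‖U‖ ^ 2 ≤
      ((χ : ℂ) ^ 2 * (F₀ * star G₀ + F₁ * star G₁) +
        star U * (F₀ * (2 * χ * d₀) + F₁ * (2 * χ * d₁))).re := by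
  have h1 : ((χ : ℂ) ^ 2 * (F₀ * star G₀ + F₁ * star G₁)).re =
      χ ^ 2 * (F₀ * star G₀ + F₁ * star G₁).re := by
    rw [← Complex.ofReal_pow, Complex.re_ofReal_mul]
  have h2 : ‖star U * (F₀ * (2 * χ * d₀) + F₁ * (2 * χ * d₁))‖ ≤
      4 * m * (χ * (‖G₀‖ + ‖G₁‖)) * ‖U‖ := by
    have e1 : ‖F₀ * d₀ + F₁ * d₁‖ ≤ 2 * (m * (‖G₀‖ + ‖G₁‖)) := by
      refine (norm_add_le _ _).trans ?_
      rw [norm_mul, norm_mul]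
      have := mul_le_mul hF₀ hd₀ (norm_nonneg _) ((norm_nonneg _).trans hF₀)
      have := mul_le_mul hF₁ hd₁ (norm_nonneg _) ((norm_nonneg _).trans hF₁)
      rw [hm]; linarith
    have e2 : star U * (F₀ * (2 * χ * d₀) + F₁ * (2 * χ * d₁)) =
        star U * ((2 * χ : ℝ) * (F₀ * d₀ + F₁ * d₁)) := by push_cast; ring
    rw [e2, norm_mul, norm_mul, norm_star, Complex.norm_real, Real.norm_of_nonneg (by positivity)]
    have := mul_le_mul_of_nonneg_left e1 (show 0 ≤ ‖U‖ * (2 * χ) by positivity)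
    linarith
  have h3 := (Complex.abs_re_le_norm (star U * (F₀ * (2 * χ * d₀) + F₁ * (2 * χ * d₁)))).trans h2
  have h4 := (abs_le.1 h3).1
  rw [Complex.add_re, h1]
  have h5 := mul_le_mul_of_nonneg_left hell (sq_nonneg χ)
  -- Young's inequality as a completed square, weighted so that half of the elliptic term survives;
  -- it is used once for each component of the gradient.
  have y : ∀ g : ℝ, 4 * m * (χ * g) * ‖U‖ ≤
      lam / 2 * (χ ^ 2 * g ^ 2) + 8 * m ^ 2 / lam * ‖U‖ ^ 2 := by
    intro g
    have : lam / 2 * (χ ^ 2 * g ^ 2) + 8 * m ^ 2 / lam * ‖U‖ ^ 2 - 4 * m * (χ * g) * ‖U‖ =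
        (lam * (χ * g) - 4 * m * ‖U‖) ^ 2 / (2 * lam) := by field_simp; ring
    have h := div_nonneg (sq_nonneg (lam * (χ * g) - 4 * m * ‖U‖)) (by positivity : 0 ≤ 2 * lam)
    linarith
  have y0 := y ‖G₀‖
  have y1 := y ‖G₁‖
  have : 16 * m ^ 2 / lam * ‖U‖ ^ 2 = 8 * m ^ 2 / lam * ‖U‖ ^ 2 + 8 * m ^ 2 / lam * ‖U‖ ^ 2 := by
    ring
  linarith

/-- Weak solutions with flux `(F₀, F₁)` on `Ω`, for square integrable data. -/
structure IsSol (lam M : ℝ) (Ω : Set (ℝ × ℝ)) (U G₀ G₁ F₀ F₁ : ℝ × ℝ → ℂ) : Prop where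
  U_memLp : MemLp U 2 volume
  G₀_memLp : MemLp G₀ 2 volume
  G₁_memLp : MemLp G₁ 2 volume
  F₀_memLp : MemLp F₀ 2 volume
  F₁_memLp : MemLp F₁ 2 volume
  grad₀ : WeakRel Ω (1, 0) 0 U 0 G₀
  grad₁ : WeakRel Ω (0, 1) 0 U 0 G₁
  div : WeakRel Ω (1, 0) (0, 1) F₀ F₁ 0
  elliptic : ∀ᵐ z, lam * (‖G₀ z‖ ^ 2 + ‖G₁ z‖ ^ 2) ≤
    (F₀ z * star (G₀ z) + F₁ z * star (G₁ z)).re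
  bound₀ : ∀ᵐ z, ‖F₀ z‖ ≤ M * (‖G₀ z‖ + ‖G₁ z‖)
  bound₁ : ∀ᵐ z, ‖F₁ z‖ ≤ M * (‖G₀ z‖ + ‖G₁ z‖)

/-- Caccioppoli's inequality. -/
lemma exists_caccioppoli {lam : ℝ} (hlam : 0 < lam) (M : ℝ) : ∃ C : ℝ, 0 < C ∧
    ∀ (c : ℝ × ℝ) (ρ s : ℝ), 0 < s → ∀ U G₀ G₁ F₀ F₁ : ℝ × ℝ → ℂ,
      IsSol lam M (Metric.ball c (ρ + s)) U G₀ G₁ F₀ F₁ →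
      (∫⁻ z in Metric.ball c ρ, ‖G₀ z‖ₑ ^ 2) + (∫⁻ z in Metric.ball c ρ, ‖G₁ z‖ₑ ^ 2) ≤
        ENNReal.ofReal (C / s ^ 2) * ∫⁻ z in Metric.ball c (ρ + s), ‖U z‖ₑ ^ 2 := by
  obtain ⟨K, hK, hcut⟩ := exists_cutoff
  -- The first summand is $\frac{2}{\lambda}\cdot\frac{16m^2}{\lambda}$ with $m=MK/s$ and the factor
  -- $s^{-2}$ removed; the added $1$ makes the constant positive even when $M=0$.
  refine ⟨32 * (M * K) ^ 2 / lam ^ 2 + 1, by positivity, fun c ρ s hs U G₀ G₁ F₀ F₁ h => ?_⟩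
  obtain ⟨χ, hsm, hcs, hsub, h0, h1, hone, hd0, hd1⟩ := hcut c ρ s hs
  set B := Metric.ball c (ρ + s)
  have hBm : MeasurableSet B := Metric.isOpen_ball.measurableSet
  have hφ : IsTestFunction B (fun z => ((χ z : ℂ)) ^ 2) :=
    ⟨(Complex.ofRealCLM.contDiff.comp hsm).pow 2,
      hcs.comp_left (g := fun x : ℝ => (x : ℂ) ^ 2) (by simp),
      (closure_mono (Function.support_subset_iff'.2 fun z hz => by
    simp [Function.notMem_support.1 hz])).trans hsub⟩
  have hder : ∀ z e, fderiv ℝ (fun z => ((χ z : ℂ)) ^ 2) z e =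
      2 * χ z * (fderiv ℝ χ z e : ℂ) := by
    intro z e
    have d1 : HasFDerivAt (fun z => (χ z : ℂ)) _ z :=
      (Complex.ofRealCLM.hasFDerivAt (x := χ z)).comp z
        (hsm.differentiable (by simp) z).hasFDerivAt
    rw [(d1.pow 2).fderiv]
    simp
  -- The pairing is applied to $\overline U$ and its gradient with cutoff $\chi^2$, so the main term
  -- is $\chi^2F\cdot\overline G$, which ellipticity bounds below.
  have hdc := integral_div_curl Metric.isOpen_ball h.U_memLp.star h.G₀_memLp.star
    h.G₁_memLp.star h.F₀_memLp h.F₁_memLp (by simpa using! h.grad₀.star)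
    (by simpa using! h.grad₁.star) h.div hφ
  simp only [hder] at hdc
  set W : ℝ × ℝ → ℂ := fun z => (χ z : ℂ) ^ 2 * (F₀ z * star (G₀ z) + F₁ z * star (G₁ z)) +
    star (U z) * (F₀ z * (2 * χ z * (fderiv ℝ χ z (1, 0) : ℂ)) +
      F₁ z * (2 * χ z * (fderiv ℝ χ z (0, 1) : ℂ))) with hW
  have hdc' : ∫ z, W z = 0 := hdc
  have hWi : Integrable W := by
    have a0 := integrable_mul_of_memLp_two h.F₀_memLp (memLp_mul_of_hasCompactSupport
      hφ.smooth.continuous hφ.compact h.G₀_memLp.star)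
    have a1 := integrable_mul_of_memLp_two h.F₁_memLp (memLp_mul_of_hasCompactSupport
      hφ.smooth.continuous hφ.compact h.G₁_memLp.star)
    have a2 := integrable_mul_of_memLp_two h.F₀_memLp (memLp_mul_of_hasCompactSupport
      (hφ.continuous_fderiv (1, 0)) (hφ.compact.fderiv_apply ℝ _) h.U_memLp.star)
    have a3 := integrable_mul_of_memLp_two h.F₁_memLp (memLp_mul_of_hasCompactSupport
      (hφ.continuous_fderiv (0, 1)) (hφ.compact.fderiv_apply ℝ _) h.U_memLp.star)
    refine ((a0.add a1).add (a2.add a3)).congr (Eventually.of_forall fun z => ?_)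
    simp only [Pi.add_apply, hder, hW, Pi.star_apply]
    ring
  set k := K / s
  set m := M * k
  have hpt : ∀ᵐ z, lam / 2 * ((Metric.ball c ρ).indicator (fun z => ‖G₀ z‖ ^ 2 + ‖G₁ z‖ ^ 2) z) -
      16 * m ^ 2 / lam * (B.indicator (fun z => ‖U z‖ ^ 2) z) ≤ (W z).re := by
    filter_upwards [h.elliptic, h.bound₀, h.bound₁] with z he hb0 hb1
    by_cases hz : z ∈ B
    · have := caccioppoli_pointwise (χ := χ z) (m := m) (U := U z)
        (d₀ := (fderiv ℝ χ z (1, 0) : ℂ)) (d₁ := (fderiv ℝ χ z (0, 1) : ℂ)) hlam (h0 z)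
        rfl he hb0 hb1 (by simpa using hd0 z) (by simpa using hd1 z)
      refine le_trans ?_ this
      rw [indicator_of_mem hz]
      refine sub_le_sub_right (mul_le_mul_of_nonneg_left ?_ (by positivity)) _
      by_cases hz' : z ∈ Metric.ball c ρ
      · rw [indicator_of_mem hz', hone z hz']; simp
      · rw [indicator_of_notMem hz']
        exact mul_nonneg (sq_nonneg _) (by positivity)
    · have hz' : z ∉ Metric.ball c ρ := fun hz' =>
        hz (Metric.ball_subset_ball (by linarith) hz')
      have hχ : χ z = 0 := image_eq_zero_of_notMem_tsupport fun hzt => hz (hsub hzt)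
      rw [indicator_of_notMem hz, indicator_of_notMem hz']
      simp [hW, hχ]
  have sq : ∀ {a : ℝ × ℝ → ℂ}, MemLp a 2 volume → Integrable (fun z => ‖a z‖ ^ 2) := fun ha =>
    ha.integrable_norm_pow (by norm_num)
  have iG : Integrable (fun z => ‖G₀ z‖ ^ 2 + ‖G₁ z‖ ^ 2) :=
    (sq h.G₀_memLp).add (sq h.G₁_memLp)
  have iG' := iG.indicator (Metric.isOpen_ball (x := c) (ε := ρ)).measurableSet
  have iU' := (sq h.U_memLp).indicator hBm
  have hint := integral_mono_ae ((iG'.const_mul (lam / 2)).sub (iU'.const_mul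
    (16 * m ^ 2 / lam))) hWi.re hpt
  have hre : ∫ z, (W z).re = 0 := by
    have := integral_re hWi
    simp only [RCLike.re_to_complex] at this
    rw [this, hdc']; simp
  simp only [RCLike.re_to_complex, Pi.sub_apply] at hint
  rw [hre, integral_sub (iG'.const_mul _) (iU'.const_mul _), integral_const_mul,
    integral_const_mul, integral_indicator Metric.isOpen_ball.measurableSet,
    integral_indicator hBm, integral_add (sq h.G₀_memLp).integrableOn
    (sq h.G₁_memLp).integrableOn] at hint
  rw [lintegral_enorm_sq_eq h.G₀_memLp, lintegral_enorm_sq_eq h.G₁_memLp,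
    lintegral_enorm_sq_eq h.U_memLp, ← ENNReal.ofReal_mul (by positivity),
    ← ENNReal.ofReal_add (integral_nonneg fun z => by positivity)
      (integral_nonneg fun z => by positivity)]
  refine ENNReal.ofReal_le_ofReal ?_
  set I := ∫ z in Metric.ball c ρ, ‖G₀ z‖ ^ 2
  set J := ∫ z in Metric.ball c ρ, ‖G₁ z‖ ^ 2
  have hV : 0 ≤ ∫ z in B, ‖U z‖ ^ 2 := integral_nonneg fun z => by positivity
  set V := ∫ z in B, ‖U z‖ ^ 2
  have e1 : (32 * (M * K) ^ 2 / lam ^ 2 + 1) / s ^ 2 * V =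
      2 / lam * (16 * m ^ 2 / lam * V) + V / s ^ 2 := by
    simp only [m, k]; field_simp; ring
  have e2 : 2 / lam * (lam / 2 * (I + J)) = I + J := by field_simp
  have e3 := mul_le_mul_of_nonneg_left (sub_nonpos.1 hint) (by positivity : 0 ≤ 2 / lam)
  rw [e1, ← e2]
  have : 0 ≤ V / s ^ 2 := by positivity
  linarith


/-! ### Pointwise bounds from $t$-derivatives and one first-order relation. -/

/-- The values of $g$ at two points of the interval differ by at most $\int|g'|$; averaging over one
of them gives the one-dimensional embedding $W^{1,1}\subset L^\infty$. -/
lemma enorm_le_lintegral_Ioo {g : ℝ → ℂ} (hg : ContDiff ℝ 1 g) {a b t₀ : ℝ}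
    (ht₀ : t₀ ∈ Ioo a b) :
    ‖g t₀‖ₑ ≤ ∫⁻ t in Ioo a b, (ENNReal.ofReal (1 / (b - a)) * ‖g t‖ₑ + ‖deriv g t‖ₑ) := by
  have hab : 0 < b - a := by linarith [ht₀.1, ht₀.2]
  have hc : Continuous (deriv g) := hg.continuous_deriv le_rfl
  have hgc : Continuous g := hg.continuous
  set D := ∫⁻ t in Ioo a b, ‖deriv g t‖ₑ with hD
  have h1 : ∀ t ∈ Ioo a b, ‖g t₀‖ₑ ≤ ‖g t‖ₑ + D := by
    intro t ht
    have hi : ∫ x in t..t₀, deriv g x = g t₀ - g t :=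
      intervalIntegral.integral_eq_sub_of_hasDerivAt
        (fun x _ => (hg.differentiable (by simp) x).hasDerivAt) (hc.intervalIntegrable _ _)
    have h2 : g t₀ = g t + ∫ x in t..t₀, deriv g x := by rw [hi]; ring
    have h3 : ‖∫ x in t..t₀, deriv g x‖ₑ ≤ D := by
      rw [← ofReal_norm, intervalIntegral.norm_intervalIntegral_eq, ofReal_norm]
      refine (enorm_integral_le_lintegral_enorm _).trans (lintegral_mono_set ?_)
      intro x hx
      rw [uIoc, mem_Ioc] at hx
      exact ⟨(lt_min ht.1 ht₀.1).trans hx.1, hx.2.trans_lt (max_lt ht.2 ht₀.2)⟩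
    calc ‖g t₀‖ₑ ≤ ‖g t‖ₑ + ‖∫ x in t..t₀, deriv g x‖ₑ := by
          conv_lhs => rw [h2]
          exact enorm_add_le _ _
      _ ≤ _ := by gcongr
  set k := ENNReal.ofReal (1 / (b - a))
  have hk : k * volume (Ioo a b) = 1 := by
    rw [Real.volume_Ioo, ← ENNReal.ofReal_mul (by positivity), one_div,
      inv_mul_cancel₀ hab.ne', ENNReal.ofReal_one]
  have hconst : ∀ x : ℝ≥0∞, ∫⁻ _ in Ioo a b, k * x = x := by
    intro x
    rw [lintegral_const, Measure.restrict_apply_univ, mul_right_comm, hk, one_mul]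
  calc ‖g t₀‖ₑ = ∫⁻ _ in Ioo a b, k * ‖g t₀‖ₑ := (hconst _).symm
    _ ≤ ∫⁻ t in Ioo a b, (k * ‖g t‖ₑ + k * D) := by
        refine setLIntegral_mono (by fun_prop) fun t ht => ?_
        rw [← mul_add]
        gcongr
        exact h1 t ht
    _ = (∫⁻ t in Ioo a b, k * ‖g t‖ₑ) + D := by
        rw [lintegral_add_left (by fun_prop), hconst]
    _ = _ := by rw [lintegral_add_left (by fun_prop)]

/-- The classical partial derivative in the `t`-direction. -/
noncomputable def dt (u : ℝ × ℝ → ℂ) (z : ℝ × ℝ) : ℂ := fderiv ℝ u z (1, 0)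

lemma contDiff_dt {u : ℝ × ℝ → ℂ} (hu : ContDiff ℝ ∞ u) : ContDiff ℝ ∞ (dt u) :=
  (hu.fderiv_right (m := ∞) (by simp)).clm_apply contDiff_const

lemma hasDerivAt_fst_line {u : ℝ × ℝ → ℂ} (hu : ContDiff ℝ ∞ u) (t x : ℝ) :
    HasDerivAt (fun t => u (t, x)) (dt u (t, x)) t :=
  ((hu.differentiable (by simp) (t, x)).hasFDerivAt).comp_hasDerivAt t
    ((hasDerivAt_id t).prodMk (hasDerivAt_const t x))

lemma hasDerivAt_snd_line {u : ℝ × ℝ → ℂ} (hu : ContDiff ℝ ∞ u) (t x : ℝ) :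
    HasDerivAt (fun x => u (t, x)) (fderiv ℝ u (t, x) (0, 1)) x :=
  ((hu.differentiable (by simp) (t, x)).hasFDerivAt).comp_hasDerivAt x
    ((hasDerivAt_const x t).prodMk (hasDerivAt_id x))

lemma ball_eq_prod (c : ℝ × ℝ) (ρ : ℝ) : Metric.ball c ρ =
    Ioo (c.1 - ρ) (c.1 + ρ) ×ˢ Ioo (c.2 - ρ) (c.2 + ρ) := (cube_eq_ball c ρ).symm

lemma volume_ball_prod (c : ℝ × ℝ) {ρ : ℝ} (hρ : 0 ≤ ρ) :
    volume (Metric.ball c ρ) = ENNReal.ofReal ((2 * ρ) ^ 2) := by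
  rw [ball_eq_prod, Measure.volume_eq_prod, Measure.prod_prod, Real.volume_Ioo, Real.volume_Ioo,
    ← ENNReal.ofReal_mul (by linarith)]
  congr 1; ring

/-- Pointwise bound for a smooth function by its mixed first-order derivatives. -/
lemma enorm_le_lintegral_ball {p q : ℝ × ℝ → ℂ} (hp : ContDiff ℝ ∞ p) (hq : ContDiff ℝ ∞ q)
    {c : ℝ × ℝ} {ρ : ℝ}
    (hpq : ∀ z ∈ Metric.ball c ρ, fderiv ℝ p z (0, 1) + dt q z = 0)
    {z₀ : ℝ × ℝ} (hz₀ : z₀ ∈ Metric.ball c ρ) :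
    ‖p z₀‖ₑ ≤ ∫⁻ z in Metric.ball c ρ,
      (ENNReal.ofReal (1 / (2 * ρ)) * (ENNReal.ofReal (1 / (2 * ρ)) * ‖p z‖ₑ + ‖dt p z‖ₑ) +
        (ENNReal.ofReal (1 / (2 * ρ)) * ‖dt q z‖ₑ + ‖dt (dt q) z‖ₑ)) := by
  set k := ENNReal.ofReal (1 / (2 * ρ))
  have hpt := contDiff_dt hp
  have hqt := contDiff_dt hq
  have hqtt := contDiff_dt hqt
  have c0 := hp.continuous
  have c1 := hpt.continuous
  have c2 := hqt.continuous
  have c3 := hqtt.continuous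
  have m0 := c0.measurable
  have m1 := c1.measurable
  rw [ball_eq_prod] at hz₀
  obtain ⟨t₀, x₀⟩ := z₀
  have e1 : c.1 + ρ - (c.1 - ρ) = 2 * ρ := by ring
  have e2 : c.2 + ρ - (c.2 - ρ) = 2 * ρ := by ring
  have line : ∀ u : ℝ × ℝ → ℂ, ContDiff ℝ ∞ u → ∀ x, ‖u (t₀, x)‖ₑ ≤
      ∫⁻ t in Ioo (c.1 - ρ) (c.1 + ρ), (k * ‖u (t, x)‖ₑ + ‖dt u (t, x)‖ₑ) := by
    intro u hu x
    have hl : ContDiff ℝ 1 fun t => u (t, x) :=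
      (hu.comp (contDiff_id.prodMk contDiff_const)).of_le (by simp)
    have := enorm_le_lintegral_Ioo hl hz₀.1
    simpa only [e1, (hasDerivAt_fst_line hu _ x).deriv] using this
  have hl : ContDiff ℝ 1 fun x => p (t₀, x) :=
    (hp.comp (contDiff_const.prodMk contDiff_id)).of_le (by simp)
  have h0 := enorm_le_lintegral_Ioo hl hz₀.2
  simp only [e2, (hasDerivAt_snd_line hp t₀ _).deriv] at h0
  calc ‖p (t₀, x₀)‖ₑ ≤ _ := h0
    _ ≤ ∫⁻ x in Ioo (c.2 - ρ) (c.2 + ρ), ∫⁻ t in Ioo (c.1 - ρ) (c.1 + ρ),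
          (k * (k * ‖p (t, x)‖ₑ + ‖dt p (t, x)‖ₑ) +
            (k * ‖dt q (t, x)‖ₑ + ‖dt (dt q) (t, x)‖ₑ)) := by
        refine setLIntegral_mono' measurableSet_Ioo fun x hx => ?_
        rw [lintegral_add_left (by fun_prop), lintegral_const_mul _ (by fun_prop)]
        have hz : (t₀, x) ∈ Metric.ball c ρ := by
          rw [ball_eq_prod]; exact ⟨hz₀.1, hx⟩
        -- The only $x$-derivative that occurs is exchanged for a $t$-derivative of $q$.
        have hx' : ‖fderiv ℝ p (t₀, x) (0, 1)‖ₑ = ‖dt q (t₀, x)‖ₑ := by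
          rw [eq_neg_of_add_eq_zero_left (hpq _ hz), enorm_neg]
        rw [hx']
        gcongr
        · exact line p hp x
        · exact line (dt q) hqt x
    _ = _ := by
        rw [ball_eq_prod, Measure.volume_eq_prod, ← Measure.prod_restrict, lintegral_prod_symm]
        fun_prop

lemma lintegral_enorm_le {c : ℝ × ℝ} {ρ y : ℝ} (hρ : 0 ≤ ρ) (hy : 0 ≤ y) {u : ℝ × ℝ → ℂ}
    (hu : Continuous u)
    (h : ∫⁻ z in Metric.ball c ρ, ‖u z‖ₑ ^ 2 ≤ ENNReal.ofReal (y ^ 2)) :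
    ∫⁻ z in Metric.ball c ρ, ‖u z‖ₑ ≤ ENNReal.ofReal (2 * ρ * y) := by
  have h1 := sq_lintegral_le (volume.restrict (Metric.ball c ρ)) (f := fun z => ‖u z‖ₑ)
    (by fun_prop)
  rw [Measure.restrict_apply_univ, volume_ball_prod c hρ] at h1
  have h2 : (∫⁻ z in Metric.ball c ρ, ‖u z‖ₑ) ^ 2 ≤ ENNReal.ofReal (2 * ρ * y) ^ 2 := by
    rw [← ENNReal.ofReal_pow (by positivity), mul_pow, ENNReal.ofReal_mul (by positivity)]
    exact h1.trans (by gcongr)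
  exact (ENNReal.pow_le_pow_left_iff two_ne_zero).1 h2

/-- The hypotheses are scale-invariant: each $t$-derivative costs a factor $1/\rho$. After
Cauchy–Schwarz the four terms contribute $\frac12$, $1$, $1$ and $2$ times $b/\rho$, and the sum
$\frac92$ is rounded up to $5$. -/
lemma norm_le_of_lintegral_sq_le {p q : ℝ × ℝ → ℂ} (hp : ContDiff ℝ ∞ p) (hq : ContDiff ℝ ∞ q)
    {c : ℝ × ℝ} {ρ b : ℝ} (hρ : 0 < ρ) (hb : 0 ≤ b)
    (hpq : ∀ z ∈ Metric.ball c ρ, fderiv ℝ p z (0, 1) + dt q z = 0)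
    (h0 : ∫⁻ z in Metric.ball c ρ, ‖p z‖ₑ ^ 2 ≤ ENNReal.ofReal (b ^ 2))
    (h1 : ∫⁻ z in Metric.ball c ρ, ‖dt p z‖ₑ ^ 2 ≤ ENNReal.ofReal ((b / ρ) ^ 2))
    (h2 : ∫⁻ z in Metric.ball c ρ, ‖dt q z‖ₑ ^ 2 ≤ ENNReal.ofReal ((b / ρ) ^ 2))
    (h3 : ∫⁻ z in Metric.ball c ρ, ‖dt (dt q) z‖ₑ ^ 2 ≤ ENNReal.ofReal ((b / ρ ^ 2) ^ 2))
    {z₀ : ℝ × ℝ} (hz₀ : z₀ ∈ Metric.ball c ρ) : ‖p z₀‖ ≤ 5 * (b / ρ) := by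
  have hpt := contDiff_dt hp
  have hqt := contDiff_dt hq
  have c0 := hp.continuous
  have c1 := hpt.continuous
  have c2 := hqt.continuous
  have c3 := (contDiff_dt hqt).continuous
  have h := enorm_le_lintegral_ball hp hq hpq hz₀
  rw [lintegral_add_left (by fun_prop), lintegral_const_mul _ (by fun_prop),
    lintegral_add_left (by fun_prop), lintegral_const_mul _ (by fun_prop),
    lintegral_add_left (by fun_prop), lintegral_const_mul _ (by fun_prop)] at h
  have i0 := lintegral_enorm_le hρ.le hb c0 h0
  have i1 := lintegral_enorm_le hρ.le (by positivity) c1 h1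
  have i2 := lintegral_enorm_le hρ.le (by positivity) c2 h2
  have i3 := lintegral_enorm_le hρ.le (by positivity) c3 h3
  have hk : 0 ≤ 1 / (2 * ρ) := by positivity
  have hfin : ‖p z₀‖ₑ ≤ ENNReal.ofReal (5 * (b / ρ)) := by
    calc ‖p z₀‖ₑ ≤ _ := h
      _ ≤ ENNReal.ofReal (1 / (2 * ρ)) * (ENNReal.ofReal (1 / (2 * ρ)) *
          ENNReal.ofReal (2 * ρ * b) + ENNReal.ofReal (2 * ρ * (b / ρ))) +
          (ENNReal.ofReal (1 / (2 * ρ)) * ENNReal.ofReal (2 * ρ * (b / ρ)) +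
            ENNReal.ofReal (2 * ρ * (b / ρ ^ 2))) := by gcongr
      _ = ENNReal.ofReal (1 / (2 * ρ) * (1 / (2 * ρ) * (2 * ρ * b) + 2 * ρ * (b / ρ)) +
          (1 / (2 * ρ) * (2 * ρ * (b / ρ)) + 2 * ρ * (b / ρ ^ 2))) := by
          rw [ENNReal.ofReal_add (by positivity) (by positivity), ENNReal.ofReal_mul hk,
            ENNReal.ofReal_add (by positivity) (by positivity), ENNReal.ofReal_mul hk,
            ENNReal.ofReal_add (by positivity) (by positivity), ENNReal.ofReal_mul hk]
      _ ≤ _ := by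
          refine ENNReal.ofReal_le_ofReal ?_
          have : 1 / (2 * ρ) * (1 / (2 * ρ) * (2 * ρ * b) + 2 * ρ * (b / ρ)) +
              (1 / (2 * ρ) * (2 * ρ * (b / ρ)) + 2 * ρ * (b / ρ ^ 2)) = 9 / 2 * (b / ρ) := by
            field_simp; ring
          rw [this]
          have : 0 ≤ b / ρ := by positivity
          linarith
  rw [← ofReal_norm] at hfin
  exact (ENNReal.ofReal_le_ofReal_iff (by positivity)).1 hfin

lemma tendsto_dq {u : ℝ × ℝ → ℂ} (hu : ContDiff ℝ ∞ u) {s : ℝ} (hs : 0 < s) (z : ℝ × ℝ) :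
    Tendsto (fun n : ℕ => dq (s / (n + 1)) u z) atTop (𝓝 (dt u z)) := by
  obtain ⟨t, x⟩ := z
  have h := (hasDerivAt_iff_tendsto_slope_zero.1 (hasDerivAt_fst_line hu t x))
  have hl : Tendsto (fun n : ℕ => s / ((n : ℝ) + 1)) atTop (𝓝[≠] 0) := by
    refine tendsto_nhdsWithin_iff.2 ⟨?_, Eventually.of_forall fun n => ?_⟩
    · have := (tendsto_one_div_add_atTop_nhds_zero_nat (𝕜 := ℝ)).const_mul s
      simpa [div_eq_mul_inv] using this
    · exact (show s / ((n : ℝ) + 1) ≠ 0 by positivity)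
  refine (h.comp hl).congr fun n => ?_
  simp [dq]

/-- Fatou's lemma as the increment tends to $0$: uniform bounds on difference quotients pass to the
derivative. -/
lemma lintegral_dt_sq_le {u : ℝ × ℝ → ℂ} (hu : ContDiff ℝ ∞ u) {s : ℝ} (hs : 0 < s)
    {S : Set (ℝ × ℝ)} {B : ℝ≥0∞} (h : ∀ h, |h| ≤ s → ∫⁻ z in S, ‖dq h u z‖ₑ ^ 2 ≤ B) :
    ∫⁻ z in S, ‖dt u z‖ₑ ^ 2 ≤ B := by
  refine lintegral_sq_le_of_tendsto (u := fun n : ℕ => dq (s / (n + 1)) u) (fun n => ?_)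
    (Eventually.of_forall fun z => tendsto_dq hu hs z) (Eventually.of_forall fun n => h _ ?_)
  · have := hu.continuous
    unfold dq
    fun_prop
  · rw [abs_of_pos (by positivity)]
    exact div_le_self hs.le (by linarith [(n.cast_nonneg : (0 : ℝ) ≤ n)])

lemma contDiff_dq {u : ℝ × ℝ → ℂ} (hu : ContDiff ℝ ∞ u) (h : ℝ) : ContDiff ℝ ∞ (dq h u) :=
  contDiff_const.mul ((hu.comp (contDiff_id.add contDiff_const)).sub hu)

lemma dt_dq {u : ℝ × ℝ → ℂ} (hu : ContDiff ℝ ∞ u) (h : ℝ) : dt (dq h u) = dq h (dt u) := by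
  ext ⟨t, x⟩
  have h1 := hasDerivAt_fst_line hu t x
  have h2 := (hasDerivAt_fst_line hu (t + h) x).comp_add_const t h
  have h3 := (h2.sub h1).const_mul (h : ℂ)⁻¹
  have h4 := hasDerivAt_fst_line (contDiff_dq hu h) t x
  rw [← h4.deriv]
  have : (fun t => dq h u (t, x)) =
      fun t => (h : ℂ)⁻¹ * (u (t + h, x) - u (t, x)) := by
    ext t; simp [dq]
  rw [this]
  refine h3.deriv.trans ?_
  simp [dq]

/-- Because $\partial_t$ commutes with difference quotients, the limits in the two increments can be
taken one at a time. -/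
lemma lintegral_dt_dt_sq_le {u : ℝ × ℝ → ℂ} (hu : ContDiff ℝ ∞ u) {s : ℝ} (hs : 0 < s)
    {S : Set (ℝ × ℝ)} {B : ℝ≥0∞}
    (h : ∀ h k, |h| ≤ s → |k| ≤ s → ∫⁻ z in S, ‖dq h (dq k u) z‖ₑ ^ 2 ≤ B) :
    ∫⁻ z in S, ‖dt (dt u) z‖ₑ ^ 2 ≤ B := by
  refine lintegral_dt_sq_le (contDiff_dt hu) hs fun k hk => ?_
  rw [← dt_dq hu]
  exact lintegral_dt_sq_le (contDiff_dq hu k) hs fun h' hh => h h' k hh hk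

lemma moll_dq (η : ContDiffBump (0 : ℝ × ℝ)) {a : ℝ × ℝ → ℂ} (ha : MemLp a 2 volume) (h : ℝ) :
    moll η (dq h a) = dq h (moll η a) := by
  ext z
  have hex : ∀ w, Integrable fun y => η.normed volume y • a (w - y) := fun w =>
    (η.hasCompactSupport_normed (μ := volume)).convolutionExists_left
      (ContinuousLinearMap.lsmul ℝ ℝ) η.continuous_normed (locallyIntegrable_of_memLp_two ha) w
  simp only [dq, moll_apply']
  rw [← integral_sub (hex _) (hex _), ← integral_const_mul]
  congr 1; ext y
  rw [sub_add_eq_add_sub]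
  simp only [Complex.real_smul]; ring

/-- A function whose `x`-derivative is a `t`-derivative is bounded, given control on difference
quotients in `t`. -/
lemma ae_norm_le_of_dq {c : ℝ × ℝ} {ρ s b : ℝ} (hρ : 0 < ρ) (hs : 0 < s) (hb : 0 ≤ b)
    {p q : ℝ × ℝ → ℂ} (hp : MemLp p 2 volume) (hq : MemLp q 2 volume)
    (hr : WeakRel (Metric.ball c (ρ + s)) (0, 1) (1, 0) p q 0)
    (h0 : ∫⁻ z in Metric.ball c (ρ + s), ‖p z‖ₑ ^ 2 ≤ ENNReal.ofReal (b ^ 2))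
    (h1 : ∀ h, |h| ≤ s →
      ∫⁻ z in Metric.ball c (ρ + s), ‖dq h p z‖ₑ ^ 2 ≤ ENNReal.ofReal ((b / ρ) ^ 2))
    (h2 : ∀ h, |h| ≤ s →
      ∫⁻ z in Metric.ball c (ρ + s), ‖dq h q z‖ₑ ^ 2 ≤ ENNReal.ofReal ((b / ρ) ^ 2))
    (h3 : ∀ h k, |h| ≤ s → |k| ≤ s →
      ∫⁻ z in Metric.ball c (ρ + s), ‖dq h (dq k q) z‖ₑ ^ 2 ≤ ENNReal.ofReal ((b / ρ ^ 2) ^ 2)) :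
    ∀ᵐ z, z ∈ Metric.ball c ρ → ‖p z‖ ≤ 5 * (b / ρ) := by
  filter_upwards [ae_tendsto_moll hp] with z hlim hz
  refine le_of_tendsto hlim.norm ?_
  -- Mollification commutes with difference quotients, so Young's inequality transfers every
  -- hypothesis to the smooth functions with the same constants, at the cost of the margin $s$.
  filter_upwards [eventually_bumpSeq_le hs] with n hn
  have sp := contDiff_moll (bumpSeq n) hp
  have sq := contDiff_moll (bumpSeq n) hq
  have young : ∀ {g : ℝ × ℝ → ℂ}, MemLp g 2 volume → _ := fun hg =>
    lintegral_moll_sq_le (bumpSeq n) hn hg c ρ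
  refine norm_le_of_lintegral_sq_le sp sq hρ hb (fun w hw => ?_) ((young hp).trans h0)
    (lintegral_dt_sq_le sp hs fun h hh => ?_) (lintegral_dt_sq_le sq hs fun h hh => ?_)
    (lintegral_dt_dt_sq_le sq hs fun h k hh hk => ?_) hz
  · have := hr.mollify hp hq MemLp.zero (bumpSeq n) (z := w)
      (Metric.closedBall_subset_ball' (by rw [Metric.mem_ball] at hw; linarith))
    rw [dt, this]; simp [moll_apply]
  · rw [← moll_dq _ hp]; exact (young (memLp_dq hp h)).trans (h1 h hh)
  · rw [← moll_dq _ hq]; exact (young (memLp_dq hq h)).trans (h2 h hh)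
  · rw [← moll_dq _ hq, ← moll_dq _ (memLp_dq hq k)]
    exact (young (memLp_dq (memLp_dq hq k) h)).trans (h3 h k hh hk)


/-! ### Solutions with their flux, iterated difference quotients and the gradient bound. -/

/-- The quantifier over vectors stands inside the almost-everywhere statement, so a single null set
serves all gradients. The bound $|M|+1$ is at least $1$ whatever the sign of $M$. -/
lemma IsEllipticCoeff.pointwise {lam M : ℝ} {A : ℝ → Matrix (Fin 2) (Fin 2) ℂ}
    (hA : IsEllipticCoeff lam M A) : ∀ᵐ x, ∀ g₀ g₁ : ℂ,
      lam * (‖g₀‖ ^ 2 + ‖g₁‖ ^ 2) ≤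
        ((A x 0 0 * g₀ + A x 0 1 * g₁) * star g₀ + (A x 1 0 * g₀ + A x 1 1 * g₁) * star g₁).re ∧
      ‖A x 0 0 * g₀ + A x 0 1 * g₁‖ ≤ (|M| + 1) * (‖g₀‖ + ‖g₁‖) ∧
      ‖A x 1 0 * g₀ + A x 1 1 * g₁‖ ≤ (|M| + 1) * (‖g₀‖ + ‖g₁‖) := by
  filter_upwards [hA.bounded, hA.elliptic] with x hb he g₀ g₁
  have hn : ‖(!₂[g₀, g₁] : C2)‖ ≤ ‖g₀‖ + ‖g₁‖ := by
    rw [EuclideanSpace.norm_eq, Fin.sum_univ_two]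
    refine Real.sqrt_le_iff.2 ⟨by positivity, ?_⟩
    simp only [Matrix.cons_val_zero, Matrix.cons_val_one]
    nlinarith [norm_nonneg g₀, norm_nonneg g₁]
  have hop : ‖Matrix.toEuclideanCLM (𝕜 := ℂ) (A x) !₂[g₀, g₁]‖ ≤
      (|M| + 1) * (‖g₀‖ + ‖g₁‖) := by
    refine (ContinuousLinearMap.le_opNorm _ _).trans (mul_le_mul ?_ hn (norm_nonneg _) ?_)
    · exact hb.trans ((le_abs_self M).trans (by linarith))
    · positivity
  refine ⟨?_, ?_, ?_⟩
  · have := he !₂[g₀, g₁]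
    rw [EuclideanSpace.norm_sq_eq] at this
    simpa [Matrix.mulVec, dotProduct, Fin.sum_univ_two] using this
  · refine le_trans ?_ hop
    have := PiLp.norm_apply_le (Matrix.toEuclideanCLM (𝕜 := ℂ) (A x) !₂[g₀, g₁]) 0
    simpa [Matrix.mulVec, dotProduct, Fin.sum_univ_two] using this
  · refine le_trans ?_ hop
    have := PiLp.norm_apply_le (Matrix.toEuclideanCLM (𝕜 := ℂ) (A x) !₂[g₀, g₁]) 1
    simpa [Matrix.mulVec, dotProduct, Fin.sum_univ_two] using this

lemma ae_snd {P : ℝ → Prop} (h : ∀ᵐ x, P x) : ∀ᵐ z : ℝ × ℝ, P z.2 :=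
  (Measure.quasiMeasurePreserving_snd (μ := volume) (ν := volume)).ae h

/-- Square integrable solutions together with their flux `F = A ∇U`. -/
structure IsFluxSol (A : ℝ → Matrix (Fin 2) (Fin 2) ℂ) (Ω : Set (ℝ × ℝ))
    (U G₀ G₁ F₀ F₁ : ℝ × ℝ → ℂ) : Prop where
  U_memLp : MemLp U 2 volume
  G₀_memLp : MemLp G₀ 2 volume
  G₁_memLp : MemLp G₁ 2 volume
  F₀_memLp : MemLp F₀ 2 volume
  F₁_memLp : MemLp F₁ 2 volume
  grad₀ : WeakRel Ω (1, 0) 0 U 0 G₀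
  grad₁ : WeakRel Ω (0, 1) 0 U 0 G₁
  div : WeakRel Ω (1, 0) (0, 1) F₀ F₁ 0
  flux₀ : ∀ z, F₀ z = A z.2 0 0 * G₀ z + A z.2 0 1 * G₁ z
  flux₁ : ∀ z, F₁ z = A z.2 1 0 * G₀ z + A z.2 1 1 * G₁ z

namespace IsFluxSol

variable {A : ℝ → Matrix (Fin 2) (Fin 2) ℂ} {Ω : Set (ℝ × ℝ)} {U G₀ G₁ F₀ F₁ : ℝ × ℝ → ℂ}

lemma mono {Ω' : Set (ℝ × ℝ)} (h : IsFluxSol A Ω U G₀ G₁ F₀ F₁) (hs : Ω' ⊆ Ω) :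
    IsFluxSol A Ω' U G₀ G₁ F₀ F₁ :=
  { h with grad₀ := h.grad₀.mono hs, grad₁ := h.grad₁.mono hs, div := h.div.mono hs }

lemma isSol {lam M : ℝ} (hA : IsEllipticCoeff lam M A) (h : IsFluxSol A Ω U G₀ G₁ F₀ F₁) :
    IsSol lam (|M| + 1) Ω U G₀ G₁ F₀ F₁ :=
  { h with
    elliptic := by
      filter_upwards [ae_snd hA.pointwise] with z hz
      rw [h.flux₀, h.flux₁]; exact (hz _ _).1
    bound₀ := by
      filter_upwards [ae_snd hA.pointwise] with z hz
      rw [h.flux₀]; exact (hz _ _).2.1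
    bound₁ := by
      filter_upwards [ae_snd hA.pointwise] with z hz
      rw [h.flux₁]; exact (hz _ _).2.2 }

/-- This is where $t$-independence enters: a shift in $t$ leaves $A(x)$ unchanged, so the flux of a
difference quotient is the difference quotient of the flux. -/
lemma diffQuot {c : ℝ × ℝ} {R s : ℝ} (H : IsFluxSol A (Metric.ball c R) U G₀ G₁ F₀ F₁)
    {h : ℝ} (hs : |h| ≤ s) :
    IsFluxSol A (Metric.ball c (R - s)) (dq h U) (dq h G₀) (dq h G₁) (dq h F₀) (dq h F₁) where
  U_memLp := memLp_dq H.U_memLp h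
  G₀_memLp := memLp_dq H.G₀_memLp h
  G₁_memLp := memLp_dq H.G₁_memLp h
  F₀_memLp := memLp_dq H.F₀_memLp h
  F₁_memLp := memLp_dq H.F₁_memLp h
  grad₀ := by
    have := H.grad₀.diffQuot H.U_memLp MemLp.zero H.G₀_memLp hs
    rwa [show dq h 0 = 0 from dq_zero_fun h] at this
  grad₁ := by
    have := H.grad₁.diffQuot H.U_memLp MemLp.zero H.G₁_memLp hs
    rwa [show dq h 0 = 0 from dq_zero_fun h] at this
  div := by
    have := H.div.diffQuot H.F₀_memLp H.F₁_memLp MemLp.zero hs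
    rwa [show dq h 0 = 0 from dq_zero_fun h] at this
  flux₀ z := by simp only [dq, H.flux₀, Prod.snd_add, add_zero]; ring
  flux₁ z := by simp only [dq, H.flux₁, Prod.snd_add, add_zero]; ring

end IsFluxSol

lemma IsTestFunction.fderiv {Ω : Set (ℝ × ℝ)} {φ : ℝ × ℝ → ℂ} (hφ : IsTestFunction Ω φ)
    (e : ℝ × ℝ) : IsTestFunction Ω fun z => fderiv ℝ φ z e where
  smooth := (hφ.smooth.fderiv_right (m := ∞) (by simp)).clm_apply contDiff_const
  compact := hφ.compact.fderiv_apply ℝ e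
  subset := (tsupport_fderiv_apply_subset ℝ e).trans hφ.subset

/-- Weak gradients are curl-free. -/
lemma WeakRel.curl {Ω : Set (ℝ × ℝ)} {U G₀ G₁ : ℝ × ℝ → ℂ} (hU : MemLp U 2 volume)
    (hG₀ : MemLp G₀ 2 volume) (hG₁ : MemLp G₁ 2 volume)
    (h₀ : WeakRel Ω (1, 0) 0 U 0 G₀) (h₁ : WeakRel Ω (0, 1) 0 U 0 G₁) :
    WeakRel Ω (0, 1) (1, 0) G₀ (fun z => -G₁ z) 0 := by
  -- The gradient relations are tested with $\partial_x\varphi$ and $\partial_t\varphi$ and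
  -- subtracted; the terms in $U$ cancel by symmetry of second derivatives.
  intro φ hφ
  have t0 := hφ.fderiv (0, 1)
  have t1 := hφ.fderiv (1, 0)
  have := integral_sub (integrable_weakRel t0 (1, 0) 0 hU MemLp.zero hG₀)
    (integrable_weakRel t1 (0, 1) 0 hU MemLp.zero hG₁)
  rw [h₀ _ t0, h₁ _ t1, sub_zero] at this
  rw [← this]
  congr 1; ext z
  have hd : ∀ e v, _root_.fderiv ℝ (fun z => _root_.fderiv ℝ φ z e) z v =
      _root_.fderiv ℝ (_root_.fderiv ℝ φ) z v e := by
    intro e v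
    have hdiff : DifferentiableAt ℝ (_root_.fderiv ℝ φ) z :=
      (hφ.smooth.fderiv_right (m := ∞) (by simp)).differentiable (by simp) z
    rw [fderiv_clm_apply hdiff (differentiableAt_const e)]
    simp
  have hsymm := (hφ.smooth.contDiffAt (x := z)).isSymmSndFDerivAt
    (by simpa using! WithTop.coe_le_coe.2 (le_top : (2 : ℕ∞) ≤ ⊤))
  rw [hd (0, 1) (1, 0), hd (1, 0) (0, 1), hsymm.eq (1, 0) (0, 1)]
  simp only [Pi.zero_apply]
  ring

lemma WeakRel.swap {Ω : Set (ℝ × ℝ)} {e f : ℝ × ℝ} {a b d : ℝ × ℝ → ℂ}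
    (h : WeakRel Ω e f a b d) : WeakRel Ω f e b a d := by
  intro φ hφ
  rw [← h φ hφ]
  congr 1; ext z; ring

lemma lintegral_flux_sq_le {M : ℝ} {F G₀ G₁ : ℝ × ℝ → ℂ}
    (hG₀ : MemLp G₀ 2 volume) (hG₁ : MemLp G₁ 2 volume)
    (h : ∀ᵐ z, ‖F z‖ ≤ M * (‖G₀ z‖ + ‖G₁ z‖)) (S : Set (ℝ × ℝ)) :
    ∫⁻ z in S, ‖F z‖ₑ ^ 2 ≤ ENNReal.ofReal (2 * M ^ 2) *
      ((∫⁻ z in S, ‖G₀ z‖ₑ ^ 2) + ∫⁻ z in S, ‖G₁ z‖ₑ ^ 2) := by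
  have m0 : AEMeasurable (fun z => ‖G₀ z‖ₑ ^ 2) (volume.restrict S) :=
    (hG₀.1.restrict.enorm).pow_const 2
  have m1 : AEMeasurable (fun z => ‖G₁ z‖ₑ ^ 2) (volume.restrict S) :=
    (hG₁.1.restrict.enorm).pow_const 2
  have m01 : AEMeasurable (fun z => ‖G₀ z‖ₑ ^ 2 + ‖G₁ z‖ₑ ^ 2) (volume.restrict S) := m0.add m1
  rw [← lintegral_add_left' m0, ← lintegral_const_mul'' _ m01]
  refine lintegral_mono_ae (ae_restrict_of_ae ?_)
  filter_upwards [h] with z hz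
  rw [← ofReal_norm, ← ofReal_norm, ← ofReal_norm, ← ENNReal.ofReal_pow (norm_nonneg _),
    ← ENNReal.ofReal_pow (norm_nonneg _), ← ENNReal.ofReal_pow (norm_nonneg _),
    ← ENNReal.ofReal_add (by positivity) (by positivity), ← ENNReal.ofReal_mul (by positivity)]
  refine ENNReal.ofReal_le_ofReal ?_
  calc ‖F z‖ ^ 2 ≤ (M * (‖G₀ z‖ + ‖G₁ z‖)) ^ 2 := by gcongr
    _ = M ^ 2 * (‖G₀ z‖ + ‖G₁ z‖) ^ 2 := by ring
    _ ≤ M ^ 2 * (2 * (‖G₀ z‖ ^ 2 + ‖G₁ z‖ ^ 2)) := by gcongr; exact add_sq_le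
    _ = _ := by ring

/-- Interior estimate for difference quotients of solutions. -/
lemma exists_dq_estimate {lam : ℝ} (hlam : 0 < lam) (M : ℝ) : ∃ C : ℝ, 0 < C ∧
    ∀ A : ℝ → Matrix (Fin 2) (Fin 2) ℂ, IsEllipticCoeff lam M A →
    ∀ (c : ℝ × ℝ) (σ s : ℝ), 0 < s → ∀ U G₀ G₁ F₀ F₁ : ℝ × ℝ → ℂ,
      IsFluxSol A (Metric.ball c (σ + 3 * s)) U G₀ G₁ F₀ F₁ → ∀ h, |h| ≤ s →
      (∫⁻ z in Metric.ball c σ, ‖dq h G₀ z‖ₑ ^ 2) +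
        (∫⁻ z in Metric.ball c σ, ‖dq h G₁ z‖ₑ ^ 2) ≤
        ENNReal.ofReal (C / s ^ 2) * ((∫⁻ z in Metric.ball c (σ + 3 * s), ‖G₀ z‖ₑ ^ 2) +
          ∫⁻ z in Metric.ball c (σ + 3 * s), ‖G₁ z‖ₑ ^ 2) := by
  obtain ⟨C, hC, hcac⟩ := exists_caccioppoli hlam (|M| + 1)
  refine ⟨C, hC, fun A hA c σ s hs U G₀ G₁ F₀ F₁ H h hh => ?_⟩
  -- Of the margin $3s$, Caccioppoli uses $s$, and replacing the difference quotient of $U$ by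
  -- $\partial_tU$ uses $2s$.
  have e : σ + s + 2 * s = σ + 3 * s := by ring
  refine (hcac c σ s hs _ _ _ _ _ (((H.diffQuot hh).mono
    (Metric.ball_subset_ball (by linarith))).isSol hA)).trans ?_
  have := (e ▸ H.grad₀ : WeakRel (Metric.ball c (σ + s + 2 * s)) _ _ _ _ _).lintegral_dq_sq_le
    H.U_memLp H.G₀_memLp hh hs
  rw [e] at this
  gcongr
  exact this.trans le_self_add

/-- The interior gradient bound for square integrable solutions. -/
lemma exists_flux_bound {lam : ℝ} (hlam : 0 < lam) (M : ℝ) : ∃ K : ℝ, 0 < K ∧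
    ∀ A : ℝ → Matrix (Fin 2) (Fin 2) ℂ, IsEllipticCoeff lam M A →
    ∀ (c : ℝ × ℝ) (r : ℝ), 0 < r → ∀ U G₀ G₁ F₀ F₁ : ℝ × ℝ → ℂ,
      IsFluxSol A (Metric.ball c (r + 7 * (r / 16))) U G₀ G₁ F₀ F₁ → ∀ β : ℝ, 0 ≤ β →
      (∫⁻ z in Metric.ball c (r + 7 * (r / 16)), ‖G₀ z‖ₑ ^ 2) +
        (∫⁻ z in Metric.ball c (r + 7 * (r / 16)), ‖G₁ z‖ₑ ^ 2) ≤ ENNReal.ofReal (β ^ 2) →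
      ∀ᵐ z, z ∈ Metric.ball c r → ‖G₀ z‖ ≤ K * (β / r) ∧ ‖G₁ z‖ ≤ K * (β / r) := by
  obtain ⟨C, hC, hdq⟩ := exists_dq_estimate hlam M
  set M' := |M| + 1 with hM'
  have hM1 : 1 ≤ M' := by simp [hM']
  -- $L^2$ dominates $2M'^2$ times each of $1$, $256C$ and $(256C)^2$, so the single value
  -- $b=L\beta$ serves all orders of difference quotients, for the gradient as well as the flux.
  set L := 2 * M' * (1 + 256 * C) with hL
  have hL0 : 0 < L := by positivity
  refine ⟨5 * L * (1 + (1 + M') / lam), by positivity,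
    fun A hA c r hr U G₀ G₁ F₀ F₁ H β hβ hB => ?_⟩
  -- The radii go $r\to r+s\to r+4s\to r+7s$: a margin $s$ for mollification and $3s$ for each of
  -- two difference-quotient estimates. With $s=r/16$ the last radius stays below $2r$.
  set s := r / 16 with hs
  have hs0 : 0 < s := by positivity
  have hCs : C / s ^ 2 = 256 * C / r ^ 2 := by rw [hs]; field_simp; norm_num
  set R := r + 7 * s with hR
  set N : ℝ → (ℝ × ℝ → ℂ) → ℝ≥0∞ := fun σ u => ∫⁻ z in Metric.ball c σ, ‖u z‖ₑ ^ 2 with hN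
  have hNmono : ∀ {σ σ'} (u : ℝ × ℝ → ℂ), σ ≤ σ' → N σ u ≤ N σ' u := fun u h =>
    lintegral_mono_set (Metric.ball_subset_ball h)
  have est0 : N (r + s) G₀ + N (r + s) G₁ ≤ ENNReal.ofReal (β ^ 2) :=
    (add_le_add (hNmono G₀ (by linarith)) (hNmono G₁ (by linarith))).trans hB
  have est1 : ∀ k, |k| ≤ s → ∀ σ, σ + 3 * s ≤ R → N σ (dq k G₀) + N σ (dq k G₁) ≤
      ENNReal.ofReal (256 * C / r ^ 2 * β ^ 2) := by
    intro k hk σ hσ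
    refine (hdq A hA c σ s hs0 U G₀ G₁ F₀ F₁ (H.mono (Metric.ball_subset_ball hσ)) k hk).trans ?_
    rw [hCs, ENNReal.ofReal_mul (by positivity)]
    gcongr
    exact (add_le_add (hNmono G₀ hσ) (hNmono G₁ hσ)).trans hB
  have est2 : ∀ h k, |h| ≤ s → |k| ≤ s → N (r + s) (dq h (dq k G₀)) +
      N (r + s) (dq h (dq k G₁)) ≤ ENNReal.ofReal ((256 * C / r ^ 2) ^ 2 * β ^ 2) := by
    intro h k hh hk
    refine (hdq A hA c (r + s) s hs0 _ _ _ _ _ ((H.diffQuot hk).mono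
      (Metric.ball_subset_ball (by linarith))) h hh).trans ?_
    rw [hCs, sq (256 * C / r ^ 2), mul_assoc, ENNReal.ofReal_mul (p := 256 * C / r ^ 2)
      (by positivity)]
    gcongr
    exact est1 k hk _ (by linarith)
  have hb : 0 ≤ L * β := by positivity
  have C1 : 2 * M' ^ 2 * β ^ 2 ≤ (L * β) ^ 2 := by
    rw [mul_pow]
    refine mul_le_mul_of_nonneg_right ?_ (sq_nonneg _)
    rw [hL]
    nlinarith [mul_nonneg (sq_nonneg M') hC.le, mul_nonneg (sq_nonneg M') (sq_nonneg C),
      sq_nonneg M']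
  have C2 : 2 * M' ^ 2 * (256 * C / r ^ 2 * β ^ 2) ≤ (L * β / r) ^ 2 := by
    have : 2 * M' ^ 2 * (256 * C) ≤ L ^ 2 := by
      rw [hL]
      nlinarith [mul_nonneg (sq_nonneg M') hC.le, mul_nonneg (sq_nonneg M') (sq_nonneg C),
        sq_nonneg M']
    calc _ = 2 * M' ^ 2 * (256 * C) * (β ^ 2 / r ^ 2) := by ring
      _ ≤ L ^ 2 * (β ^ 2 / r ^ 2) := by gcongr
      _ = _ := by ring
  have C3 : 2 * M' ^ 2 * ((256 * C / r ^ 2) ^ 2 * β ^ 2) ≤ (L * β / r ^ 2) ^ 2 := by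
    have : 2 * M' ^ 2 * (256 * C) ^ 2 ≤ L ^ 2 := by
      rw [hL]
      nlinarith [mul_nonneg (sq_nonneg M') hC.le, mul_nonneg (sq_nonneg M') (sq_nonneg C),
        sq_nonneg M']
    calc _ = 2 * M' ^ 2 * (256 * C) ^ 2 * (β ^ 2 / (r ^ 2) ^ 2) := by ring
      _ ≤ L ^ 2 * (β ^ 2 / (r ^ 2) ^ 2) := by gcongr
      _ = _ := by ring
  have hM2 : 1 ≤ 2 * M' ^ 2 := by nlinarith
  have up : ∀ {x : ℝ≥0∞} {y w : ℝ}, 0 ≤ y → 2 * M' ^ 2 * y ≤ w → x ≤ ENNReal.ofReal y →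
      x ≤ ENNReal.ofReal w := fun {x y w} hy hw hx =>
    hx.trans (ENNReal.ofReal_le_ofReal (by nlinarith))
  have upF : ∀ {x : ℝ≥0∞} {y w : ℝ}, 0 ≤ y → 2 * M' ^ 2 * y ≤ w → x ≤ ENNReal.ofReal y →
      ENNReal.ofReal (2 * M' ^ 2) * x ≤ ENNReal.ofReal w := fun {x y w} hy hw hx => by
    refine le_trans ?_ (ENNReal.ofReal_le_ofReal hw)
    rw [ENNReal.ofReal_mul (p := 2 * M' ^ 2) (by positivity)]
    gcongr
  have e1 : ∀ k, |k| ≤ s → N (r + s) (dq k G₀) + N (r + s) (dq k G₁) ≤ _ :=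
    fun k hk => est1 k hk (r + s) (by linarith)
  have hneg : ∀ h (u : ℝ × ℝ → ℂ), dq h (fun z => -u z) = fun z => -dq h u z := by
    intro h u; ext z; simp only [dq]; ring
  have hcurl := (WeakRel.curl H.U_memLp H.G₀_memLp H.G₁_memLp H.grad₀ H.grad₁).mono
    (Metric.ball_subset_ball (show r + s ≤ R by linarith))
  have hdiv := H.div.swap.mono (Metric.ball_subset_ball (show r + s ≤ R by linarith))
  have p1 : 0 ≤ 256 * C / r ^ 2 * β ^ 2 := by positivity
  have p2 : 0 ≤ (256 * C / r ^ 2) ^ 2 * β ^ 2 := by positivity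
  -- The curl relation is used with $p=G_0$, $q=-G_1$.
  have bound0 := ae_norm_le_of_dq hr hs0 hb H.G₀_memLp H.G₁_memLp.neg hcurl
    (up (sq_nonneg _) C1 (le_self_add.trans est0))
    (fun h hh => up p1 C2 (le_self_add.trans (e1 h hh)))
    (fun h hh => by
      rw [show dq h (-G₁) = _ from hneg h G₁]
      simp only [enorm_neg]
      exact up p1 C2 (le_add_self.trans (e1 h hh)))
    (fun h k hh hk => by
      rw [show dq k (-G₁) = _ from hneg k G₁, hneg h]
      simp only [enorm_neg]
      exact up p2 C3 (le_add_self.trans (est2 h k hh hk)))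
  have hM0 : 0 ≤ M' := by linarith
  -- The divergence relation is used with $p=F_1$, $q=F_0$. Flux bounds follow from gradient bounds
  -- because difference quotients of the flux are again fluxes.
  have bound1 := ae_norm_le_of_dq hr hs0 hb H.F₁_memLp H.F₀_memLp hdiv
    ((lintegral_flux_sq_le H.G₀_memLp H.G₁_memLp (H.isSol hA).bound₁ _).trans
      (upF (sq_nonneg _) C1 est0))
    (fun h hh => by
      have D := H.diffQuot hh
      exact (lintegral_flux_sq_le D.G₀_memLp D.G₁_memLp (D.isSol hA).bound₁ _).trans
        (upF p1 C2 (e1 h hh)))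
    (fun h hh => by
      have D := H.diffQuot hh
      exact (lintegral_flux_sq_le D.G₀_memLp D.G₁_memLp (D.isSol hA).bound₀ _).trans
        (upF p1 C2 (e1 h hh)))
    (fun h k hh hk => by
      have D := (H.diffQuot hk).diffQuot hh
      exact (lintegral_flux_sq_le D.G₀_memLp D.G₁_memLp (D.isSol hA).bound₀ _).trans
        (upF p2 C3 (est2 h k hh hk)))
  filter_upwards [bound0, bound1, ae_snd hA.pointwise] with z h0 h1 hp hz
  replace h0 := h0 hz
  replace h1 := h1 hz
  -- Ellipticity tested on the second basis vector; this allows $G_1$ to be solved for from $F_1$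
  -- and $G_0$.
  have a11 : lam ≤ ‖A z.2 1 1‖ := by
    have := (hp 0 1).1
    simp only [norm_zero, norm_one, star_one, mul_one, mul_zero, zero_add, star_zero] at this
    exact (by simpa using this : lam ≤ (A z.2 1 1).re).trans (Complex.re_le_norm _)
  have a10 : ‖A z.2 1 0‖ ≤ M' := by
    have := (hp 1 0).2.2
    simpa using this
  have hG1 : lam * ‖G₁ z‖ ≤ (1 + M') * (5 * (L * β / r)) := by
    calc lam * ‖G₁ z‖ ≤ ‖A z.2 1 1‖ * ‖G₁ z‖ := by gcongr
      _ = ‖F₁ z - A z.2 1 0 * G₀ z‖ := by rw [← norm_mul, H.flux₁]; congr 1; ring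
      _ ≤ ‖F₁ z‖ + ‖A z.2 1 0‖ * ‖G₀ z‖ := by
        rw [← norm_mul]; exact norm_sub_le _ _
      _ ≤ 5 * (L * β / r) + M' * (5 * (L * β / r)) := by gcongr
      _ = _ := by ring
  have q0 : 0 ≤ L * β / r := by positivity
  constructor
  · calc ‖G₀ z‖ ≤ 5 * (L * β / r) := h0
      _ ≤ 5 * (L * β / r) * (1 + (1 + M') / lam) :=
        le_mul_of_one_le_right (by positivity) (by
          have : 0 ≤ (1 + M') / lam := by positivity
          linarith)
      _ = _ := by ring
  · calc ‖G₁ z‖ ≤ (1 + M') * (5 * (L * β / r)) / lam := by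
          rw [le_div_iff₀ hlam]; linarith
      _ = 5 * (L * β / r) * ((1 + M') / lam) := by ring
      _ ≤ 5 * (L * β / r) * (1 + (1 + M') / lam) := by gcongr; linarith
      _ = _ := by ring


/-! ### Localisation of harmonic functions and conclusion. -/

lemma memLp_indicator_of_memL2Loc {Ω K : Set (ℝ × ℝ)} {f : ℝ × ℝ → ℂ} (hf : MemL2Loc Ω f)
    (hK : IsCompact K) (hs : K ⊆ Ω) : MemLp (K.indicator f) 2 volume :=
  (memLp_indicator_iff_restrict hK.measurableSet).2 (hf K hs hK)

lemma MemL2Loc.apply {Ω : Set (ℝ × ℝ)} {G : ℝ × ℝ → C2} (hG : MemL2Loc Ω G) (i : Fin 2) :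
    MemL2Loc Ω fun z => G z i :=
  fun K hs hK => (EuclideanSpace.proj i : C2 →L[ℂ] ℂ).comp_memLp' (hG K hs hK)

lemma setIntegral_mul_eq_of_support {Ω K S : Set (ℝ × ℝ)} (hS : S ⊆ K) (hK : K ⊆ Ω)
    {f ψ : ℝ × ℝ → ℂ} (hψ : ∀ z, z ∉ S → ψ z = 0) :
    ∫ z in Ω, f z * ψ z = ∫ z, K.indicator f z * ψ z := by
  rw [setIntegral_eq_integral_of_forall_compl_eq_zero fun z hz => by
    rw [hψ z fun h => hz (hK (hS h)), mul_zero]]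
  congr 1; ext z
  by_cases hz : z ∈ S
  · rw [indicator_of_mem (hS hz)]
  · rw [hψ z hz, mul_zero, mul_zero]

lemma IsTestFunction.fderiv_apply_eq_zero {Ω : Set (ℝ × ℝ)} {φ : ℝ × ℝ → ℂ}
    (hφ : IsTestFunction Ω φ) (e : ℝ × ℝ) {z : ℝ × ℝ} (hz : z ∉ Ω) :
    _root_.fderiv ℝ φ z e = 0 :=
  image_eq_zero_of_notMem_tsupport (f := fun z => _root_.fderiv ℝ φ z e)
    fun hh => hz ((hφ.fderiv e).subset hh)

/-- Truncation to a compact $K\supseteq B$ makes the data globally square integrable and is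
invisible to test functions supported in $B$. -/
lemma HasWeakGradient.weakRel {Ω B K : Set (ℝ × ℝ)} (hBK : B ⊆ K) (hK : K ⊆ Ω)
    (hKc : IsCompact K) {U : ℝ × ℝ → ℂ} {G : ℝ × ℝ → C2} (h : HasWeakGradient Ω U G) (i : Fin 2)
    {e : ℝ × ℝ} (he : ∀ φ z, grad φ z i = fderiv ℝ φ z e) :
    WeakRel B e 0 (K.indicator U) 0 (K.indicator fun z => G z i) := by
  intro φ hφ
  have h1 := h.integral_eq φ (hφ.mono (hBK.trans hK)) i
  simp only [he] at h1
  have z0 : ∀ z, z ∉ B → φ z = 0 := fun z hz =>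
    image_eq_zero_of_notMem_tsupport fun hh => hz (hφ.subset hh)
  have z1 : ∀ z, z ∉ B → fderiv ℝ φ z e = 0 := fun z hz => hφ.fderiv_apply_eq_zero e hz
  rw [setIntegral_mul_eq_of_support hBK hK z1, setIntegral_mul_eq_of_support hBK hK z0] at h1
  have i1 := integrable_mul_of_memLp_two (memLp_indicator_of_memL2Loc h.memL2Loc hKc hK)
    (hφ.memLp_fderiv e)
  have i2 := integrable_mul_of_memLp_two
    (memLp_indicator_of_memL2Loc (h.grad_memL2Loc.apply i) hKc hK) hφ.memLp
  simp only [Pi.zero_apply, zero_mul, add_zero]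
  rw [integral_add i1 i2, h1, neg_add_cancel]

lemma memLp_coeff_mul {lam M : ℝ} {A : ℝ → Matrix (Fin 2) (Fin 2) ℂ}
    (hA : IsEllipticCoeff lam M A) (i j : Fin 2) {g : ℝ × ℝ → ℂ} (hg : MemLp g 2 volume) :
    MemLp (fun z => A z.2 i j * g z) 2 volume := by
  refine MemLp.mul (q := 2) (p := ⊤) hg (memLp_top_of_bound (C := |M| + 1) ?_ ?_)
  · exact ((hA.aemeasurable i j).aestronglyMeasurable).comp_snd
  · filter_upwards [ae_snd hA.pointwise] with z hz
    have h1 := hz 1 0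
    have h2 := hz 0 1
    fin_cases i <;> fin_cases j
    · simpa using h1.2.1
    · simpa using h2.2.1
    · simpa using h1.2.2
    · simpa using h2.2.2

lemma IsHarmonic.isFluxSol {lam M : ℝ} {A : ℝ → Matrix (Fin 2) (Fin 2) ℂ}
    (hA : IsEllipticCoeff lam M A) {Ω B K : Set (ℝ × ℝ)} (hBK : B ⊆ K) (hK : K ⊆ Ω)
    (hKc : IsCompact K) {U : ℝ × ℝ → ℂ} {G : ℝ × ℝ → C2} (h : IsHarmonic A Ω U G) :
    IsFluxSol A B (K.indicator U) (K.indicator fun z => G z 0) (K.indicator fun z => G z 1)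
      (fun z => A z.2 0 0 * K.indicator (fun z => G z 0) z +
        A z.2 0 1 * K.indicator (fun z => G z 1) z)
      (fun z => A z.2 1 0 * K.indicator (fun z => G z 0) z +
        A z.2 1 1 * K.indicator (fun z => G z 1) z) where
  U_memLp := memLp_indicator_of_memL2Loc h.hasWeakGradient.memL2Loc hKc hK
  G₀_memLp := memLp_indicator_of_memL2Loc (h.hasWeakGradient.grad_memL2Loc.apply 0) hKc hK
  G₁_memLp := memLp_indicator_of_memL2Loc (h.hasWeakGradient.grad_memL2Loc.apply 1) hKc hK
  F₀_memLp :=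
    (memLp_coeff_mul hA 0 0 (memLp_indicator_of_memL2Loc
      (h.hasWeakGradient.grad_memL2Loc.apply 0) hKc hK)).add
    (memLp_coeff_mul hA 0 1 (memLp_indicator_of_memL2Loc
      (h.hasWeakGradient.grad_memL2Loc.apply 1) hKc hK))
  F₁_memLp :=
    (memLp_coeff_mul hA 1 0 (memLp_indicator_of_memL2Loc
      (h.hasWeakGradient.grad_memL2Loc.apply 0) hKc hK)).add
    (memLp_coeff_mul hA 1 1 (memLp_indicator_of_memL2Loc
      (h.hasWeakGradient.grad_memL2Loc.apply 1) hKc hK))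
  grad₀ := h.hasWeakGradient.weakRel hBK hK hKc 0 fun φ z => by simp [grad]
  grad₁ := h.hasWeakGradient.weakRel hBK hK hKc 1 fun φ z => by simp [grad]
  div := by
    intro φ hφ
    -- The weak equation conjugates its test function whereas `WeakRel` does not, so it is tested
    -- with $\overline\varphi$.
    have h1 := h.weak_eq _ (hφ.star.mono (hBK.trans hK))
    have hd : ∀ z v, _root_.fderiv ℝ (fun z => Star.star (φ z)) z v =
        Star.star (_root_.fderiv ℝ φ z v) := by
      intro z v
      rw [fderiv_star]; rfl
    have hdot : ∀ z, (A z.2 *ᵥ (G z).ofLp) ⬝ᵥ star (grad (fun z => Star.star (φ z)) z).ofLp =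
        (A z.2 0 0 * G z 0 + A z.2 0 1 * G z 1) * _root_.fderiv ℝ φ z (1, 0) +
          (A z.2 1 0 * G z 0 + A z.2 1 1 * G z 1) * _root_.fderiv ℝ φ z (0, 1) := by
      intro z
      simp only [grad, hd]
      simp [Matrix.mulVec, dotProduct, Fin.sum_univ_two]
    simp only [hdot] at h1
    rw [setIntegral_eq_integral_of_forall_compl_eq_zero fun z hz => by
      have hzB : z ∉ B := fun hh => hz (hK (hBK hh))
      rw [hφ.fderiv_apply_eq_zero _ hzB, hφ.fderiv_apply_eq_zero _ hzB]; ring] at h1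
    rw [← h1]
    congr 1; ext z
    by_cases hz : z ∈ B
    · simp [indicator_of_mem (hBK hz)]
    · simp [hφ.fderiv_apply_eq_zero _ hz]
  flux₀ z := rfl
  flux₁ z := rfl

lemma C2.enorm_sq (g : C2) : ‖g‖ₑ ^ 2 = ‖g 0‖ₑ ^ 2 + ‖g 1‖ₑ ^ 2 := by
  rw [← ofReal_norm, ← ofReal_norm, ← ofReal_norm, ← ENNReal.ofReal_pow (norm_nonneg _),
    ← ENNReal.ofReal_pow (norm_nonneg _), ← ENNReal.ofReal_pow (norm_nonneg _),
    ← ENNReal.ofReal_add (by positivity) (by positivity), EuclideanSpace.norm_sq_eq,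
    Fin.sum_univ_two]

lemma C2.norm_le (g : C2) : ‖g‖ ≤ ‖g 0‖ + ‖g 1‖ := by
  rw [EuclideanSpace.norm_eq, Fin.sum_univ_two]
  refine Real.sqrt_le_iff.2 ⟨by positivity, ?_⟩
  nlinarith [norm_nonneg (g 0), norm_nonneg (g 1)]

lemma quadMean_eq (c : ℝ × ℝ) {r : ℝ} (hr : 0 < r) (G : ℝ × ℝ → C2) :
    quadMean (cube c (2 * r)) G =
      ENNReal.ofReal (1 / (4 * r)) *
        (∫⁻ z in Metric.ball c (2 * r), ‖G z‖ₑ ^ 2) ^ (1 / 2 : ℝ) := by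
  rw [quadMean, setLAverage_eq, cube_eq_ball, volume_ball_prod c (by positivity),
    ENNReal.div_eq_inv_mul, ENNReal.mul_rpow_of_nonneg _ _ (by norm_num),
    ← ENNReal.ofReal_inv_of_pos (by positivity),
    ENNReal.ofReal_rpow_of_nonneg (by positivity) (by norm_num)]
  simp only [ENNReal.rpow_two]
  congr 2
  rw [← Real.sqrt_eq_rpow, ← inv_pow, Real.sqrt_sq (by positivity), one_div]
  congr 1; ring

/-- The interior `L^∞` gradient bound for `𝓛`-harmonic functions. -/
lemma exists_gradient_bound {lam : ℝ} (hlam : 0 < lam) (M : ℝ) : ∃ C : ℝ, 0 < C ∧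
    ∀ A : ℝ → Matrix (Fin 2) (Fin 2) ℂ, IsEllipticCoeff lam M A →
    ∀ (c : ℝ × ℝ) (r : ℝ), 0 < r → ∀ (U : ℝ × ℝ → ℂ) (G : ℝ × ℝ → C2),
      IsHarmonic A (cube c (2 * r)) U G →
      eLpNorm G ⊤ (volume.restrict (cube c r)) ≤
        ENNReal.ofReal C * quadMean (cube c (2 * r)) G := by
  obtain ⟨K, hK, hbd⟩ := exists_flux_bound hlam M
  -- The two components give $|G|\le 2K\beta/r$, and the mean over $2Q$ equals $\beta/(4r)$, hence
  -- the factor $8$.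
  refine ⟨8 * K, by positivity, fun A hA c r hr U G h => ?_⟩
  rw [quadMean_eq c hr]
  set N := ∫⁻ z in Metric.ball c (2 * r), ‖G z‖ₑ ^ 2 with hN
  -- The gradient is only locally square integrable in $2Q$, so $N$ may be infinite; the bound is
  -- then trivial because both prefactors are nonzero.
  rcases eq_or_ne N ⊤ with hNt | hNt
  · rw [hNt, ENNReal.top_rpow_of_pos (by norm_num), ENNReal.mul_top, ENNReal.mul_top]
    · exact le_top
    · exact (ENNReal.ofReal_pos.2 (by positivity)).ne'
    · exact (ENNReal.ofReal_pos.2 (by positivity)).ne'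
  rw [cube_eq_ball] at h ⊢
  set R := r + 7 * (r / 16) with hR
  set β := √N.toReal with hβ
  have hNβ : N = ENNReal.ofReal (β ^ 2) := by
    rw [hβ, Real.sq_sqrt ENNReal.toReal_nonneg, ENNReal.ofReal_toReal hNt]
  have hsub : Metric.closedBall c R ⊆ Metric.ball c (2 * r) :=
    Metric.closedBall_subset_ball (by rw [hR]; linarith)
  have H := h.isFluxSol hA (Metric.ball_subset_closedBall (x := c) (ε := R)) hsub
    (isCompact_closedBall c R)
  have hB : (∫⁻ z in Metric.ball c R,
        ‖(Metric.closedBall c R).indicator (fun z => G z 0) z‖ₑ ^ 2) +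
      (∫⁻ z in Metric.ball c R,
        ‖(Metric.closedBall c R).indicator (fun z => G z 1) z‖ₑ ^ 2) ≤
      ENNReal.ofReal (β ^ 2) := by
    rw [← hNβ, ← lintegral_add_left' (H.G₀_memLp.1.restrict.enorm.pow_const 2), hN]
    refine le_trans ?_ (lintegral_mono_set (Metric.ball_subset_closedBall.trans hsub))
    refine setLIntegral_mono' Metric.isOpen_ball.measurableSet fun z hz => ?_
    rw [indicator_of_mem (Metric.ball_subset_closedBall hz),
      indicator_of_mem (Metric.ball_subset_closedBall hz), C2.enorm_sq]
  have hfin := hbd A hA c r hr _ _ _ _ _ H β (Real.sqrt_nonneg _) hB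
  have hrhs : ENNReal.ofReal (8 * K) * (ENNReal.ofReal (1 / (4 * r)) * N ^ (1 / 2 : ℝ)) =
      ENNReal.ofReal (2 * (K * (β / r))) := by
    have hβ0 : 0 ≤ β := Real.sqrt_nonneg _
    rw [hNβ, ENNReal.ofReal_rpow_of_nonneg (by positivity) (by norm_num), ← Real.sqrt_eq_rpow,
      Real.sqrt_sq hβ0, ← ENNReal.ofReal_mul (by positivity),
      ← ENNReal.ofReal_mul (by positivity)]
    congr 1; field_simp; ring
  rw [hrhs, eLpNorm_exponent_top]
  refine eLpNormEssSup_le_of_ae_bound ?_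
  rw [ae_restrict_iff' Metric.isOpen_ball.measurableSet]
  filter_upwards [hfin] with z hz hzr
  have hzK : z ∈ Metric.closedBall c R := Metric.ball_subset_closedBall
    (Metric.ball_subset_ball (by rw [hR]; linarith) hzr)
  have := hz hzr
  rw [indicator_of_mem hzK, indicator_of_mem hzK] at this
  linarith [C2.norm_le (G z)]

lemma rpow_laverage_le_eLpNorm_top (S : Set (ℝ × ℝ)) (G : ℝ × ℝ → C2) {p : ℝ}
    (hp : 0 < p) :
    (⨍⁻ z in S, ‖G z‖ₑ ^ p ∂volume) ^ (1 / p) ≤ eLpNorm G ⊤ (volume.restrict S) := by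
  set E := eLpNorm G ⊤ (volume.restrict S) with hE
  have hae : ∀ᵐ z ∂(volume.restrict S), ‖G z‖ₑ ≤ E := by
    rw [hE, eLpNorm_exponent_top]; exact ae_le_eLpNormEssSup
  have h1 : ⨍⁻ z in S, ‖G z‖ₑ ^ p ∂volume ≤ E ^ p := by
    rw [setLAverage_eq]
    refine ENNReal.div_le_of_le_mul ?_
    calc ∫⁻ z in S, ‖G z‖ₑ ^ p ≤ ∫⁻ _ in S, E ^ p := by
          refine lintegral_mono_ae ?_
          filter_upwards [hae] with z hz
          gcongr
      _ = E ^ p * volume S := by rw [setLIntegral_const]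
  calc _ ≤ (E ^ p) ^ (1 / p) := by gcongr
    _ = E := by rw [← ENNReal.rpow_mul, mul_one_div_cancel hp.ne', ENNReal.rpow_one]

/-- An $L^p$ mean is at most the essential supremum, so the same constant $C$ works for every
$p\ge2$. -/
lemma meyersExponent_eq_top {A : ℝ → Matrix (Fin 2) (Fin 2) ℂ} {C : ℝ} (hC : 0 < C)
    (h : ∀ (c : ℝ × ℝ) (r : ℝ), 0 < r → ∀ (U : ℝ × ℝ → ℂ) (G : ℝ × ℝ → C2),
      IsHarmonic A (cube c (2 * r)) U G → eLpNorm G ⊤ (volume.restrict (cube c r)) ≤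
        ENNReal.ofReal C * quadMean (cube c (2 * r)) G) : meyersExponent A = ⊤ := by
  refine ENNReal.eq_top_of_forall_nnreal_le fun q => ?_
  refine le_trans ?_ (le_sSup ⟨max 2 (q : ℝ), ⟨le_max_left _ _, C, hC, ?_⟩, rfl⟩)
  · rw [← ENNReal.ofReal_coe_nnreal]
    exact ENNReal.ofReal_le_ofReal (le_max_right _ _)
  · intro c r hr U G hU
    exact (rpow_laverage_le_eLpNorm_top _ G (by positivity)).trans (h c r hr U G hU)

end MeyersPlane

theorem mainTheorem8 (lam M : ℝ) (hlam : 0 < lam) :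
    ∃ C : ℝ, 0 < C ∧
      ∀ A : ℝ → Matrix (Fin 2) (Fin 2) ℂ, MeyersPlane.IsEllipticCoeff lam M A →
        (∀ (c : ℝ × ℝ) (r : ℝ), 0 < r →
          ∀ (U : ℝ × ℝ → ℂ) (G : ℝ × ℝ → MeyersPlane.C2),
            MeyersPlane.IsHarmonic A (MeyersPlane.cube c (2 * r)) U G →
              eLpNorm G ⊤ (volume.restrict (MeyersPlane.cube c r)) ≤
                ENNReal.ofReal C * MeyersPlane.quadMean (MeyersPlane.cube c (2 * r)) G) ∧
        MeyersPlane.meyersExponent A = ⊤ := by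
  obtain ⟨C, hC, h⟩ := MeyersPlane.exists_gradient_bound hlam M
  exact ⟨C, hC, fun A hA => ⟨h A hA, MeyersPlane.meyersExponent_eq_top hC (h A hA)⟩⟩
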